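/- **Model.** Algorithms are deterministic binary fork-join algorithms on a random access machine. The *work* is the total number of operations and the *depth* is the length of the longest chain of sequentially dependent operations; a parallel loop over $k$ indices is a balanced binary tree of forks, of depth $\lceil\log_2 k\rceil$. Words hold natural numbers; a real number is an atom that can be stored, copied and compared with another one at unit cost, and nothing else. A (search) problem is in $\mathsf{NC}$ if it has such an algorithm with work polynomial in the input size $N$, depth polynomial in $\log N$, and words of $O(\log N)$ bits. **Problem.** An instance consists of $n\ge 1$ agents and $m\ge 0$ goods, additive valuations $v_i(S)=\sum_{g\in S}v_i(g)$ with real values $v_i(g)\ge 0$, and an ordering $\sigma$ of the agents. In Fixed-Order Round Robin the agents choose one good at a time, in the order $\sigma$, repeated round after round until no good is left; an agent whose turn it is takes a remaining good that it values most, with ties broken arbitrarily. An allocation $(A_1,\dots,A_n)$ of the goods is $\mathsf{EF1}$ if for all agents $i,j$ with $A_j\neq\emptyset$ there is a good $g\in A_j$ with $v_i(A_i)\ge v_i(A_j\setminus\{g\})$. **Theorem.** (1) There are a single algorithm and an absolute constant $K$ such that, given any instance (the table of the values $v_i(g)$ and the list $\sigma$), the algorithm outputs an $\mathsf{EF1}$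 allocation that is an outcome of Fixed-Order Round Robin with the ordering $\sigma$, and for all $n\ge 1$ and $m\ge 2$ it runs in depth at most $K\,n^2\log^2 m$ and work at most $K\,n\,m^{n+1}$, that is, $O(n^2\log^2 m)$ and $O(n\,m^{n+1})$, on words of $O(n\log m)$ bits. (2) For every constant $c$, the problem of computing an $\mathsf{EF1}$ allocation that is an outcome of Fixed-Order Round Robin with the given ordering, for instances with at most $c$ agents, is in $\mathsf{NC}$. -/

import Mathlib

open scoped NNReal

/-! ## Binary fork-join programs with work and depth

Programs are finite terms, independent of the input. Every construct is a constant number of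
instructions of a random access machine (values are machine words, atomic real numbers, or pointers
to pairs and arrays), except for the explicit binary fork `par` and the parallel loop `tab`.
Memory is written only at creation of a pair or an array, so that programs have no races. -/

namespace ForkJoin

/-- Data: natural numbers (machine words), real numbers (atoms that can be copied and compared and
nothing else), pairs, and arrays. -/
inductive Val where
  | nat (k : ℕ)
  | real (x : ℝ)
  | pair (a b : Val)
  | arr (k : ℕ) (f : Fin k → Val)

namespace Val

/-- The number held in a word, and `0` for data of any other kind. -/
def toNat : Val → ℕ
  | nat k => k
  | _ => 0

/-- First component of a pair (`0` if the datum is not a pair). -/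
def fst : Val → Val
  | pair a _ => a
  | _ => nat 0

/-- Second component of a pair (`0` if the datum is not a pair). -/
def snd : Val → Val
  | pair _ b => b
  | _ => nat 0

/-- Length of an array (`0` if the datum is not an array). -/
def len : Val → ℕ
  | arr k _ => k
  | _ => 0

/-- Entry of an array (`0` if out of range or not an array). -/
def get : Val → ℕ → Val
  | arr k f, i => if h : i < k then f ⟨i, h⟩ else nat 0
  | _, _ => nat 0

/-- Number of memory cells that a datum occupies. -/
def size : Val → ℕ
  | nat _ => 1
  | real _ => 1
  | pair a b => 1 + a.size + b.size
  | arr _ f => 1 + ∑ i, (f i).size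

end Val

/-- Binary word instructions. Subtraction is truncated, division and remainder are those of `ℕ`;
`le` and `eq` return `1` or `0`, and they compare two words or two real numbers. -/
inductive Op where
  | add | sub | mul | div | mod | le | eq

open Classical in
/-- The word that an instruction returns. -/
noncomputable def Op.app : Op → Val → Val → ℕ
  | add, a, b => a.toNat + b.toNat
  | sub, a, b => a.toNat - b.toNat
  | mul, a, b => a.toNat * b.toNat
  | div, a, b => a.toNat / b.toNat
  | mod, a, b => a.toNat % b.toNat
  | le, .nat a, .nat b => if a ≤ b then 1 else 0
  | le, .real x, .real y => if x ≤ y then 1 else 0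
  | le, _, _ => 0
  | eq, .nat a, .nat b => if a = b then 1 else 0
  | eq, .real x, .real y => if x = y then 1 else 0
  | eq, _, _ => 0

/-- Programs. Variables are de Bruijn indices: `var 0` is the variable that was bound last. -/
inductive Prog where
  /-- a literal -/
  | const (k : ℕ)
  /-- a variable -/
  | var (i : ℕ)
  /-- an instruction, applied to the results of two programs that run one after the other -/
  | op (o : Op) (a b : Prog)
  /-- `letIn a b`: run `a`, bind its result, run `b` -/
  | letIn (a b : Prog)
  /-- `ite c a b`: run `c`, then `a` if the result is not `0`, and `b` if it is -/
  | ite (c a b : Prog)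
  /-- binary fork and join: run both programs in parallel, return the pair of the results -/
  | par (a b : Prog)
  /-- first component of a pair -/
  | fst (a : Prog)
  /-- second component of a pair -/
  | snd (a : Prog)
  /-- length of an array -/
  | len (a : Prog)
  /-- `get a i`: an array entry -/
  | get (a i : Prog)
  /-- `tab k b`: for all `i < k` in parallel run `b` with `i` bound; return the array of results -/
  | tab (k b : Prog)
  /-- `loop k a c b`: sequential loop with at most `k` rounds, whose state starts as the result of
  `a`. In a round the round number and then the state are bound; if `c` returns `0` the loop
  ends, otherwise the result of `b` is the next state. The last state is returned. -/
  | loop (k a c b : Prog)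

/-- The outcome of a run: the result, the work (number of operations), the depth (length of the
longest chain of sequentially dependent operations) and `word`, the largest natural number
that was computed during the run. -/
structure Outcome where
  val : Val
  work : ℕ
  depth : ℕ
  word : ℕ

/-- The rounds of a sequential loop: `fuel` rounds remain, `j` rounds are over, and `s` is the
state with the cost so far. -/
def loopFrom (c b : ℕ → Val → Outcome) : (fuel j : ℕ) → (s : Outcome) → Outcome
  | 0, _, s => s
  | fuel + 1, j, s =>
    let t := c j s.val
    if t.val.toNat = 0 then
      ⟨s.val, s.work + t.work + 1, s.depth + t.depth + 1, max s.word t.word⟩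
    else
      let u := b j s.val
      loopFrom c b fuel (j + 1)
        ⟨u.val, s.work + t.work + u.work + 1, s.depth + t.depth + u.depth + 1,
          max (max s.word t.word) u.word⟩

/-- Run a program on the values `ρ` of its variables. Costs add up along sequential composition.
At a fork the work adds up and the depth is the maximum over the two branches.
A parallel loop over `k` indices is a balanced binary tree of forks, which contributes `k` to the
work and `⌈log₂ k⌉` to the depth. -/
noncomputable def Prog.run : Prog → List Val → Outcome
  | const k, _ => ⟨.nat k, 1, 1, k⟩
  | var i, ρ => ⟨ρ.getD i (.nat 0), 1, 1, 0⟩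
  | op o a b, ρ =>
    let r := a.run ρ
    let s := b.run ρ
    let k := o.app r.val s.val
    ⟨.nat k, r.work + s.work + 1, r.depth + s.depth + 1, max (max r.word s.word) k⟩
  | letIn a b, ρ =>
    let r := a.run ρ
    let s := b.run (r.val :: ρ)
    ⟨s.val, r.work + s.work + 1, r.depth + s.depth + 1, max r.word s.word⟩
  | ite c a b, ρ =>
    let r := c.run ρ
    let s := if r.val.toNat = 0 then b.run ρ else a.run ρ
    ⟨s.val, r.work + s.work + 1, r.depth + s.depth + 1, max r.word s.word⟩
  | par a b, ρ =>
    let r := a.run ρ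
    let s := b.run ρ
    ⟨.pair r.val s.val, r.work + s.work + 1, max r.depth s.depth + 1, max r.word s.word⟩
  | fst a, ρ =>
    let r := a.run ρ
    ⟨r.val.fst, r.work + 1, r.depth + 1, r.word⟩
  | snd a, ρ =>
    let r := a.run ρ
    ⟨r.val.snd, r.work + 1, r.depth + 1, r.word⟩
  | len a, ρ =>
    let r := a.run ρ
    ⟨.nat r.val.len, r.work + 1, r.depth + 1, max r.word r.val.len⟩
  | get a i, ρ =>
    let r := a.run ρ
    let s := i.run ρ
    ⟨r.val.get s.val.toNat, r.work + s.work + 1, r.depth + s.depth + 1, max r.word s.word⟩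
  | tab e b, ρ =>
    let r := e.run ρ
    let k := r.val.toNat
    let f : ℕ → Outcome := fun i => b.run (.nat i :: ρ)
    ⟨.arr k (fun i => (f i).val),
      r.work + (∑ i ∈ Finset.range k, (f i).work) + k + 1,
      r.depth + (Finset.range k).sup (fun i => (f i).depth) + Nat.clog 2 k + 1,
      max r.word ((Finset.range k).sup (fun i => (f i).word))⟩
  | loop e a c b, ρ =>
    let r := e.run ρ
    let s := a.run ρ
    loopFrom (fun j x => c.run (x :: .nat j :: ρ)) (fun j x => b.run (x :: .nat j :: ρ))
      r.val.toNat 0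
      ⟨s.val, r.work + s.work + 1, r.depth + s.depth + 1, max r.word s.word⟩

/-- A search problem, given by an encoding of its inputs and the relation between inputs and
admissible outputs, is in `NC`: one program solves it on every input with work polynomial and
depth polylogarithmic in the input size, on words of logarithmically many bits. -/
def InNC {ι : Type} (encode : ι → Val) (Admissible : ι → Val → Prop) : Prop :=
  ∃ (P : Prog) (K : ℕ), ∀ x : ι,
    Admissible x (P.run [encode x]).val ∧
    (P.run [encode x]).work ≤ K * (encode x).size ^ K ∧
    (P.run [encode x]).depth ≤ K * (Nat.log 2 (encode x).size + 1) ^ K ∧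
    (P.run [encode x]).word ≤ K * (encode x).size ^ K

end ForkJoin

/-! ## Allocation of indivisible goods -/

/-- `n ≥ 1` agents with additive valuations of `m` goods (`v i g` is the value of the good `g` for
the agent `i`) and an ordering of the agents (`σ k` is the agent at position `k`). -/
structure OrderedInstance where
  n : ℕ
  m : ℕ
  n_pos : 0 < n
  v : Fin n → Fin m → ℝ≥0
  σ : Equiv.Perm (Fin n)

namespace OrderedInstance

variable (I : OrderedInstance)

/-- An allocation is given by the agent that receives each good. -/
abbrev Allocation : Type := Fin I.m → Fin I.n

/-- The value of a set of goods for an agent. -/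
noncomputable def value (i : Fin I.n) (S : Finset (Fin I.m)) : ℝ≥0 := ∑ g ∈ S, I.v i g

/-- The goods that an agent receives. -/
def bundle (A : I.Allocation) (i : Fin I.n) : Finset (Fin I.m) :=
  Finset.univ.filter (fun g => A g = i)

/-- Envy-freeness up to one good (an empty bundle is never envied). -/
def IsEF1 (A : I.Allocation) : Prop :=
  ∀ i j, (I.bundle A j).Nonempty →
    ∃ g ∈ I.bundle A j, I.value i (I.bundle A j \ {g}) ≤ I.value i (I.bundle A i)

/-- The agent that chooses at time `t`, if the agents choose in the order `τ r` in round `r`. -/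
def turn (τ : ℕ → Equiv.Perm (Fin I.n)) (t : ℕ) : Fin I.n :=
  τ (t / I.n) ⟨t % I.n, Nat.mod_lt t I.n_pos⟩

/-- `A` is an outcome of Round Robin with the order `τ r` in round `r`: at each time `t` the agent
whose turn it is takes the good `pick t`, which it values most among the remaining goods (those
picked at time `t` or later), until no good is left. -/
def IsRoundRobin (τ : ℕ → Equiv.Perm (Fin I.n)) (A : I.Allocation) : Prop :=
  ∃ pick : Equiv.Perm (Fin I.m), ∀ t : Fin I.m,
    A (pick t) = I.turn τ t ∧
    ∀ s : Fin I.m, t ≤ s → I.v (I.turn τ t) (pick s) ≤ I.v (I.turn τ t) (pick t)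

/-- Fixed-Order Round Robin: the same order in every round. -/
def IsFixedOrderRoundRobin (A : I.Allocation) : Prop := I.IsRoundRobin (fun _ => I.σ) A

open ForkJoin

/-- The input: the `n × m` table of values, and the list of the agents in their order. -/
noncomputable def encode : Val :=
  .pair (.arr I.n fun i => .arr I.m fun g => .real (I.v i g))
    (.arr I.n fun k => .nat (I.σ k))

/-- The output: the list that gives for each good the agent that receives it. -/
def encodeAllocation (A : I.Allocation) : Val := .arr I.m fun g => .nat (A g)

/-- `out` is an EF1 allocation that is an outcome of Fixed-Order Round Robin. -/
def Solves (out : Val) : Prop :=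
  ∃ A : I.Allocation, out = I.encodeAllocation A ∧ I.IsFixedOrderRoundRobin A ∧ I.IsEF1 A

end OrderedInstance

/-!
Round Robin with a fixed order is computed in parallel by tabulating one whole round as a map on a
polynomial number of states, and by iterating this map with pointer doubling.

Ties are broken by the index of the good, so that an agent has a strict preference order `Dom`, and
its choices get worse in this order from round to round. Hence the set of the remaining goods is
determined by the last choice of every agent: a good has been taken exactly if some agent does not
prefer its own last choice to it (`avail_last`). Since there are only `m` turns, at most
`k = min n m` agents ever choose, and the last choices of these agents form a word of `k` digits in
base `m + 1`, where the digit `0` stands for "nothing yet". There are `(m + 1) ^ k ≤ 3 * m ^ k` such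
words (`add_one_pow_le`); without the cut-off at `m` agents this would fail.

For each of these words in parallel, `roundProg` finds the remaining goods and then simulates the
`k` choices of a round, each by a reduction tree in work `O(m)` and depth `O(log² m)`. This gives
`roundMap` as a table with work `O(k * m)` per entry. Then `orbitProg` computes the states after
all numbers of rounds in `O(log m)` doubling steps, and a good belongs to the position at which it
is the last choice after some number of rounds (`ownerPos_pick`).

The costs are derived with the calculus `Runs`, which has one rule for each construct of the
language of programs; the numerical constants in the bounds are generous. An outcome of Round Robin
is envy-free up to one good because every good of `j`, except the one of the first round, can be
matched with the choice that `i` made the last time before (`IsFixedOrderRoundRobin.isEF1`).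
-/

namespace ForkJoin

/-! ### A calculus of costs -/

/-- The array of the values `f 0, …, f (k - 1)`. -/
def Val.tabulate (k : ℕ) (f : ℕ → Val) : Val := .arr k fun i => f i

theorem Val.get_tabulate {k i : ℕ} (f : ℕ → Val) (h : i < k) : (tabulate k f).get i = f i := by
  simp [tabulate, get, h]

theorem Val.get_tabulate_of_le {k i : ℕ} (f : ℕ → Val) (h : k ≤ i) :
    (tabulate k f).get i = .nat 0 := by
  simp [tabulate, get, Nat.not_lt.2 h]

theorem Val.tabulate_congr {k : ℕ} {f g : ℕ → Val} (h : ∀ i < k, f i = g i) :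
    tabulate k f = tabulate k g := by
  unfold tabulate
  congr 1
  funext i
  exact h i i.2

/-- On the variables `ρ`, the program `P` returns `v`, with work at most `W` and depth at most `D`,
and computes no word greater than `B`. -/
structure Runs (P : Prog) (ρ : List Val) (v : Val) (W D B : ℕ) : Prop where
  val : (P.run ρ).val = v
  work : (P.run ρ).work ≤ W
  depth : (P.run ρ).depth ≤ D
  word : (P.run ρ).word ≤ B

namespace Runs

variable {P Q R e a b c : Prog} {ρ : List Val} {v w : Val} {W W₁ W₂ W₃ D D₁ D₂ D₃ B x y : ℕ}

theorem mono (h : Runs P ρ v W₁ D₁ B) (hW : W₁ ≤ W) (hD : D₁ ≤ D) : Runs P ρ v W D B :=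
  ⟨h.val, h.work.trans hW, h.depth.trans hD, h.word⟩

theorem congr (h : Runs P ρ v W D B) (hv : v = w) : Runs P ρ w W D B := hv ▸ h

theorem const {k : ℕ} (h : k ≤ B) : Runs (.const k) ρ (.nat k) 1 1 B :=
  ⟨rfl, le_rfl, le_rfl, h⟩

theorem var {i : ℕ} (h : ρ.getD i (.nat 0) = v) : Runs (.var i) ρ v 1 1 B :=
  ⟨h, le_rfl, le_rfl, Nat.zero_le _⟩

theorem op {o : Op} {k : ℕ} (h₁ : Runs P ρ v W₁ D₁ B) (h₂ : Runs Q ρ w W₂ D₂ B)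
    (hk : o.app v w = k) (hB : k ≤ B) :
    Runs (.op o P Q) ρ (.nat k) (W₁ + W₂ + 1) (D₁ + D₂ + 1) B := by
  obtain ⟨rfl, p₁, p₂, p₃⟩ := h₁
  obtain ⟨rfl, q₁, q₂, q₃⟩ := h₂
  subst hk
  refine ⟨rfl, ?_, ?_, ?_⟩ <;> simp only [Prog.run]
  · omega
  · omega
  · simp [p₃, q₃, hB]

theorem add (h₁ : Runs P ρ (.nat x) W₁ D₁ B) (h₂ : Runs Q ρ (.nat y) W₂ D₂ B)
    (hB : x + y ≤ B) : Runs (.op .add P Q) ρ (.nat (x + y)) (W₁ + W₂ + 1) (D₁ + D₂ + 1) B :=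
  h₁.op h₂ rfl hB

theorem sub (h₁ : Runs P ρ (.nat x) W₁ D₁ B) (h₂ : Runs Q ρ (.nat y) W₂ D₂ B)
    (hB : x ≤ B) : Runs (.op .sub P Q) ρ (.nat (x - y)) (W₁ + W₂ + 1) (D₁ + D₂ + 1) B :=
  h₁.op h₂ rfl ((Nat.sub_le _ _).trans hB)

theorem mul (h₁ : Runs P ρ (.nat x) W₁ D₁ B) (h₂ : Runs Q ρ (.nat y) W₂ D₂ B)
    (hB : x * y ≤ B) : Runs (.op .mul P Q) ρ (.nat (x * y)) (W₁ + W₂ + 1) (D₁ + D₂ + 1) B :=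
  h₁.op h₂ rfl hB

theorem div (h₁ : Runs P ρ (.nat x) W₁ D₁ B) (h₂ : Runs Q ρ (.nat y) W₂ D₂ B)
    (hB : x ≤ B) : Runs (.op .div P Q) ρ (.nat (x / y)) (W₁ + W₂ + 1) (D₁ + D₂ + 1) B :=
  h₁.op h₂ rfl ((Nat.div_le_self _ _).trans hB)

theorem mod (h₁ : Runs P ρ (.nat x) W₁ D₁ B) (h₂ : Runs Q ρ (.nat y) W₂ D₂ B)
    (hB : x ≤ B) : Runs (.op .mod P Q) ρ (.nat (x % y)) (W₁ + W₂ + 1) (D₁ + D₂ + 1) B :=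
  h₁.op h₂ rfl ((Nat.mod_le _ _).trans hB)

theorem le (h₁ : Runs P ρ (.nat x) W₁ D₁ B) (h₂ : Runs Q ρ (.nat y) W₂ D₂ B)
    (hB : 1 ≤ B) :
    Runs (.op .le P Q) ρ (.nat (if x ≤ y then 1 else 0)) (W₁ + W₂ + 1) (D₁ + D₂ + 1) B :=
  h₁.op h₂ (by simp only [Op.app]) (by split_ifs <;> omega)

theorem eq (h₁ : Runs P ρ (.nat x) W₁ D₁ B) (h₂ : Runs Q ρ (.nat y) W₂ D₂ B)
    (hB : 1 ≤ B) :
    Runs (.op .eq P Q) ρ (.nat (if x = y then 1 else 0)) (W₁ + W₂ + 1) (D₁ + D₂ + 1) B :=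
  h₁.op h₂ (by simp only [Op.app]) (by split_ifs <;> omega)

open Classical in
theorem leReal {r s : ℝ} (h₁ : Runs P ρ (.real r) W₁ D₁ B) (h₂ : Runs Q ρ (.real s) W₂ D₂ B)
    (hB : 1 ≤ B) :
    Runs (.op .le P Q) ρ (.nat (if r ≤ s then 1 else 0)) (W₁ + W₂ + 1) (D₁ + D₂ + 1) B :=
  h₁.op h₂ (by simp only [Op.app]) (by split_ifs <;> omega)

theorem letIn (h₁ : Runs P ρ v W₁ D₁ B) (h₂ : Runs Q (v :: ρ) w W₂ D₂ B) :
    Runs (.letIn P Q) ρ w (W₁ + W₂ + 1) (D₁ + D₂ + 1) B := by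
  obtain ⟨rfl, p₁, p₂, p₃⟩ := h₁
  obtain ⟨rfl, q₁, q₂, q₃⟩ := h₂
  refine ⟨rfl, ?_, ?_, ?_⟩ <;> simp only [Prog.run]
  · omega
  · omega
  · simp [p₃, q₃]

/-- Both branches may assume that they are taken. -/
theorem ite (h : Runs R ρ (.nat x) W₁ D₁ B) (h₁ : x ≠ 0 → Runs P ρ v W₂ D₂ B)
    (h₂ : x = 0 → Runs Q ρ v W₃ D₃ B) :
    Runs (.ite R P Q) ρ v (W₁ + max W₂ W₃ + 1) (D₁ + max D₂ D₃ + 1) B := by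
  obtain ⟨p₀, p₁, p₂, p₃⟩ := h
  by_cases hx : x = 0
  · obtain ⟨rfl, q₁, q₂, q₃⟩ := h₂ hx
    have : (R.run ρ).val.toNat = 0 := by rw [p₀]; exact hx
    refine ⟨?_, ?_, ?_, ?_⟩ <;> simp only [Prog.run, this, if_true]
    · omega
    · omega
    · simp [p₃, q₃]
  · obtain ⟨rfl, q₁, q₂, q₃⟩ := h₁ hx
    have : (R.run ρ).val.toNat ≠ 0 := by rw [p₀]; exact hx
    refine ⟨?_, ?_, ?_, ?_⟩ <;> simp only [Prog.run, this, if_false]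
    · omega
    · omega
    · simp [p₃, q₃]

theorem par (h₁ : Runs P ρ v W₁ D₁ B) (h₂ : Runs Q ρ w W₂ D₂ B) :
    Runs (.par P Q) ρ (.pair v w) (W₁ + W₂ + 1) (max D₁ D₂ + 1) B := by
  obtain ⟨rfl, p₁, p₂, p₃⟩ := h₁
  obtain ⟨rfl, q₁, q₂, q₃⟩ := h₂
  refine ⟨rfl, ?_, ?_, ?_⟩ <;> simp only [Prog.run]
  · omega
  · omega
  · simp [p₃, q₃]

theorem fst (h : Runs P ρ (.pair v w) W D B) : Runs (.fst P) ρ v (W + 1) (D + 1) B := by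
  obtain ⟨p₀, p₁, p₂, p₃⟩ := h
  refine ⟨?_, ?_, ?_, ?_⟩ <;> simp only [Prog.run]
  · rw [p₀]; rfl
  · omega
  · omega
  · exact p₃

theorem snd (h : Runs P ρ (.pair v w) W D B) : Runs (.snd P) ρ w (W + 1) (D + 1) B := by
  obtain ⟨p₀, p₁, p₂, p₃⟩ := h
  refine ⟨?_, ?_, ?_, ?_⟩ <;> simp only [Prog.run]
  · rw [p₀]; rfl
  · omega
  · omega
  · exact p₃

theorem len {k : ℕ} {f : ℕ → Val} (h : Runs P ρ (.tabulate k f) W D B) (hB : k ≤ B) :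
    Runs (.len P) ρ (.nat k) (W + 1) (D + 1) B := by
  obtain ⟨p₀, p₁, p₂, p₃⟩ := h
  refine ⟨?_, ?_, ?_, ?_⟩ <;> simp only [Prog.run]
  · rw [p₀]; rfl
  · omega
  · omega
  · rw [p₀]; exact max_le p₃ hB

/-- An array entry, where the index may be out of range. -/
theorem get' (h₁ : Runs P ρ v W₁ D₁ B) (h₂ : Runs Q ρ (.nat x) W₂ D₂ B) (hv : v.get x = w) :
    Runs (.get P Q) ρ w (W₁ + W₂ + 1) (D₁ + D₂ + 1) B := by
  obtain ⟨rfl, p₁, p₂, p₃⟩ := h₁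
  obtain ⟨q₀, q₁, q₂, q₃⟩ := h₂
  refine ⟨?_, ?_, ?_, ?_⟩ <;> simp only [Prog.run]
  · rw [q₀]; exact hv
  · omega
  · omega
  · simp [p₃, q₃]

theorem get {k : ℕ} {f : ℕ → Val} (h₁ : Runs P ρ (.tabulate k f) W₁ D₁ B)
    (h₂ : Runs Q ρ (.nat x) W₂ D₂ B) (hx : x < k) :
    Runs (.get P Q) ρ (f x) (W₁ + W₂ + 1) (D₁ + D₂ + 1) B :=
  h₁.get' h₂ (Val.get_tabulate f hx)

/-- A parallel loop, with a bound on the cost that is uniform in the index. -/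
theorem tab {k : ℕ} {f : ℕ → Val} (h₁ : Runs P ρ (.nat k) W₁ D₁ B)
    (h₂ : ∀ i < k, Runs Q (.nat i :: ρ) (f i) W₂ D₂ B) :
    Runs (.tab P Q) ρ (.tabulate k f) (W₁ + k * W₂ + k + 1) (D₁ + D₂ + Nat.clog 2 k + 1) B := by
  obtain ⟨p₀, p₁, p₂, p₃⟩ := h₁
  have hk : (P.run ρ).val.toNat = k := by rw [p₀]; rfl
  have hW : ∑ i ∈ Finset.range k, (Q.run (.nat i :: ρ)).work ≤ k * W₂ := by
    simpa using Finset.sum_le_card_nsmul (Finset.range k) _ W₂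
      fun i hi => (h₂ i (Finset.mem_range.1 hi)).work
  have hD : (Finset.range k).sup (fun i => (Q.run (.nat i :: ρ)).depth) ≤ D₂ :=
    Finset.sup_le fun i hi => (h₂ i (Finset.mem_range.1 hi)).depth
  have hB : (Finset.range k).sup (fun i => (Q.run (.nat i :: ρ)).word) ≤ B :=
    Finset.sup_le fun i hi => (h₂ i (Finset.mem_range.1 hi)).word
  refine ⟨?_, ?_, ?_, ?_⟩ <;> simp only [Prog.run, hk]
  · change Val.tabulate (P.run ρ).val.toNat (fun i => (Q.run (.nat i :: ρ)).val) = _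
    rw [hk]
    exact Val.tabulate_congr fun i hi => (h₂ i hi).val
  · omega
  · omega
  · exact max_le p₃ hB

end Runs

/-- The rounds `j, …, J - 1` of a sequential loop whose test fails in round `J`, unless the
rounds run out before. -/
theorem loopFrom_bounds {c b : ℕ → Val → Outcome} {s : ℕ → Val} {J Wc Dc Db B : ℕ} {Wb : ℕ → ℕ}
    (hc : ∀ j < J, (c j (s j)).val.toNat ≠ 0 ∧ (c j (s j)).work ≤ Wc ∧ (c j (s j)).depth ≤ Dc ∧
      (c j (s j)).word ≤ B)
    (hb : ∀ j < J, (b j (s j)).val = s (j + 1) ∧ (b j (s j)).work ≤ Wb j ∧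
      (b j (s j)).depth ≤ Db ∧ (b j (s j)).word ≤ B)
    (fuel j : ℕ) (o : Outcome) (hj : j ≤ J) (hJ : J ≤ j + fuel) (ho : o.val = s j)
    (hoB : o.word ≤ B)
    (hend : J < j + fuel → (c J (s J)).val.toNat = 0 ∧ (c J (s J)).work ≤ Wc ∧
      (c J (s J)).depth ≤ Dc ∧ (c J (s J)).word ≤ B) :
    (loopFrom c b fuel j o).val = s J ∧
      (loopFrom c b fuel j o).work ≤
        o.work + ∑ i ∈ Finset.Ico j J, (Wc + Wb i + 1) + (Wc + 1) ∧
      (loopFrom c b fuel j o).depth ≤ o.depth + (J - j) * (Dc + Db + 1) + (Dc + 1) ∧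
      (loopFrom c b fuel j o).word ≤ B := by
  induction fuel generalizing j o with
  | zero =>
    obtain rfl : j = J := by omega
    simp [loopFrom, ho, hoB]
  | succ fuel ih =>
    rcases Nat.lt_or_ge j J with h | h
    · obtain ⟨c₀, c₁, c₂, c₃⟩ := hc j h
      obtain ⟨b₀, b₁, b₂, b₃⟩ := hb j h
      simp only [loopFrom, ho, c₀, if_false]
      have := ih (j + 1) ⟨(b j (s j)).val, o.work + (c j (s j)).work + (b j (s j)).work + 1,
        o.depth + (c j (s j)).depth + (b j (s j)).depth + 1,
        max (max o.word (c j (s j)).word) (b j (s j)).word⟩ h (by omega) b₀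
        (by simp [hoB, c₃, b₃]) (fun h => hend (by omega))
      refine ⟨this.1, this.2.1.trans ?_, this.2.2.1.trans ?_, this.2.2.2⟩
      · rw [Finset.sum_eq_sum_Ico_succ_bot h]
        dsimp only
        omega
      · obtain ⟨d, rfl⟩ := Nat.exists_eq_add_of_lt h
        rw [show j + d + 1 - j = d + 1 by omega, show j + d + 1 - (j + 1) = d by omega]
        dsimp only
        linarith
    · obtain rfl : j = J := by omega
      obtain ⟨c₀, c₁, c₂, c₃⟩ := hend (by omega)
      simp only [loopFrom, ho, c₀, if_true]
      refine ⟨trivial, ?_, ?_, ?_⟩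
      · simp; omega
      · simp; omega
      · simp [hoB, c₃]

namespace Runs

variable {P Q R e a b c : Prog} {ρ : List Val} {v w : Val} {W W₁ W₂ W₃ D D₁ D₂ D₃ B x y : ℕ}

/-- A loop that runs for `J` rounds through the states `s 0, …, s J`. The work of a round may
depend on its number, which is needed for arrays that shrink geometrically. -/
theorem loop {s : ℕ → Val} {k J Wc Dc Db : ℕ} {Wb : ℕ → ℕ}
    (he : Runs e ρ (.nat k) W₁ D₁ B) (ha : Runs a ρ (s 0) W₂ D₂ B) (hJ : J ≤ k)
    (hc : ∀ j < J, Runs c (s j :: .nat j :: ρ) (.nat 1) Wc Dc B)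
    (hb : ∀ j < J, Runs b (s j :: .nat j :: ρ) (s (j + 1)) (Wb j) Db B)
    (hend : J < k → Runs c (s J :: .nat J :: ρ) (.nat 0) Wc Dc B) :
    Runs (.loop e a c b) ρ (s J)
      (W₁ + W₂ + 1 + ∑ j ∈ Finset.range J, (Wc + Wb j + 1) + (Wc + 1))
      (D₁ + D₂ + 1 + J * (Dc + Db + 1) + (Dc + 1)) B := by
  obtain ⟨p₀, p₁, p₂, p₃⟩ := he
  obtain ⟨q₀, q₁, q₂, q₃⟩ := ha
  have hk : (e.run ρ).val.toNat = k := by rw [p₀]; rfl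
  have := loopFrom_bounds (c := fun j x => c.run (x :: .nat j :: ρ))
    (b := fun j x => b.run (x :: .nat j :: ρ)) (s := s) (J := J) (Wc := Wc) (Dc := Dc) (Db := Db)
    (B := B) (Wb := Wb)
    (fun j hj => ⟨by rw [(hc j hj).val]; exact one_ne_zero, (hc j hj).work, (hc j hj).depth,
      (hc j hj).word⟩)
    (fun j hj => ⟨(hb j hj).val, (hb j hj).work, (hb j hj).depth, (hb j hj).word⟩) k 0
    ⟨(a.run ρ).val, (e.run ρ).work + (a.run ρ).work + 1, (e.run ρ).depth + (a.run ρ).depth + 1,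
      max (e.run ρ).word (a.run ρ).word⟩ (Nat.zero_le _) (by omega) q₀ (by simp [p₃, q₃])
    (fun h => ⟨by rw [(hend (by omega)).val]; rfl, (hend (by omega)).work,
      (hend (by omega)).depth, (hend (by omega)).word⟩)
  obtain ⟨t₀, t₁, t₂, t₃⟩ := this
  refine ⟨?_, ?_, ?_, ?_⟩ <;> simp only [Prog.run, hk]
  · exact t₀
  · refine t₁.trans ?_
    rw [Finset.range_eq_Ico]
    dsimp only
    omega
  · refine t₂.trans ?_
    dsimp only [Nat.sub_zero]
    omega
  · exact t₃

/-- A loop with a fixed number of rounds. -/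
theorem forLoop {s : ℕ → Val} {k Db : ℕ} (Wb : ℕ → ℕ)
    (he : Runs e ρ (.nat k) W₁ D₁ B) (ha : Runs a ρ (s 0) W₂ D₂ B) (hB : 1 ≤ B)
    (hb : ∀ j < k, Runs b (s j :: .nat j :: ρ) (s (j + 1)) (Wb j) Db B) :
    Runs (.loop e a (.const 1) b) ρ (s k)
      (W₁ + W₂ + 3 + ∑ j ∈ Finset.range k, (Wb j + 2))
      (D₁ + D₂ + 3 + k * (Db + 2)) B := by
  refine (he.loop (c := .const 1) ha le_rfl (fun j _ => const hB) hb
    (fun h => absurd h (lt_irrefl _))).mono ?_ ?_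
  · have : ∑ j ∈ Finset.range k, (1 + Wb j + 1) = ∑ j ∈ Finset.range k, (Wb j + 2) :=
      Finset.sum_congr rfl fun j _ => by omega
    omega
  · rw [show 1 + Db + 1 = Db + 2 by omega]
    omega

end Runs

end ForkJoin

namespace RoundRobin

/-! ### Preferences and reduction trees -/

/-- The strict preference order of an agent on choices: the choice `0` is "no good", and the choice
`g + 1` is the good `g`, of value `w g`. Goods of equal value are ordered by their index. -/
def Dom (w : ℕ → ℝ) (x y : ℕ) : Prop :=
  y = 0 ∨ x ≠ 0 ∧ if x ≤ y then w (y - 1) ≤ w (x - 1) else w (y - 1) < w (x - 1)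

section Dom

variable {w : ℕ → ℝ} {x y z : ℕ}

theorem dom_refl (w : ℕ → ℝ) (x : ℕ) : Dom w x x := by
  by_cases h : x = 0 <;> simp [Dom, h]

theorem dom_total (w : ℕ → ℝ) (x y : ℕ) : Dom w x y ∨ Dom w y x := by
  unfold Dom
  grind

theorem Dom.trans (h₁ : Dom w x y) (h₂ : Dom w y z) : Dom w x z := by
  unfold Dom at *
  grind

theorem Dom.antisymm (h₁ : Dom w x y) (h₂ : Dom w y x) : x = y := by
  unfold Dom at *
  grind

theorem Dom.le {g h : ℕ} (hd : Dom w (g + 1) (h + 1)) : w h ≤ w g := by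
  unfold Dom at hd
  grind

end Dom

open Classical in
/-- The better of two choices. -/
noncomputable def better (w : ℕ → ℝ) (x y : ℕ) : ℕ := if Dom w x y then x else y

/-- The first of two words that is not `0`. -/
def firstNonzero (x y : ℕ) : ℕ := if x = 0 then y else x

/-- The value of node `i` at height `j` of the binary tree whose leaves are `x 0, x 1, …` and in
which an inner node is the combination `c` of its two children. -/
def tree (c : ℕ → ℕ → ℕ) (x : ℕ → ℕ) : ℕ → ℕ → ℕ
  | 0, i => x i
  | j + 1, i => c (tree c x j (2 * i)) (tree c x j (2 * i + 1))

/-- The number of nodes at height `j` of a binary tree with `m` leaves. -/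
def treeLen (m : ℕ) : ℕ → ℕ
  | 0 => m
  | j + 1 => (treeLen m j + 1) / 2

theorem treeLen_succ' (m j : ℕ) : treeLen m (j + 1) = treeLen ((m + 1) / 2) j := by
  induction j with
  | zero => rfl
  | succ j ih => rw [treeLen, ih, treeLen]

theorem treeLen_le (m j : ℕ) : treeLen m j ≤ m := by
  induction j with
  | zero => exact le_rfl
  | succ j ih => rw [treeLen]; omega

/-- The levels of a tree shrink geometrically, so that it has `O(m)` inner nodes. -/
theorem sum_treeLen_le (m T : ℕ) : ∑ j ∈ Finset.range T, treeLen m (j + 1) ≤ m + T := by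
  induction T generalizing m with
  | zero => simp
  | succ T ih =>
    rw [Finset.sum_range_succ']
    have := ih ((m + 1) / 2)
    simp only [treeLen_succ' m] at this ⊢
    simp only [treeLen] at this ⊢
    omega

section tree

variable {c : ℕ → ℕ → ℕ} {x : ℕ → ℕ}

/-- If there are `m` leaves other than `0`, then the nodes to the right of them are `0`, which is
also what an access out of the range of an array returns. -/
theorem tree_eq_zero {m : ℕ} (hc : c 0 0 = 0) (hx : ∀ i, m ≤ i → x i = 0) (j i : ℕ)
    (hi : treeLen m j ≤ i) : tree c x j i = 0 := by
  induction j generalizing i with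
  | zero => exact hx i hi
  | succ j ih =>
    rw [treeLen] at hi
    rw [tree, ih _ (by omega), ih _ (by omega), hc]

theorem exists_tree_eq (hc : ∀ a b, c a b = a ∨ c a b = b) (j i : ℕ) :
    ∃ q, q < (i + 1) * 2 ^ j ∧ tree c x j i = x q := by
  induction j generalizing i with
  | zero => exact ⟨i, by simp, rfl⟩
  | succ j ih =>
    rcases hc (tree c x j (2 * i)) (tree c x j (2 * i + 1)) with h | h
    · obtain ⟨q, hq, e⟩ := ih (2 * i)
      refine ⟨q, hq.trans_le ?_, by rw [tree, h, e]⟩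
      rw [pow_succ, ← mul_assoc, mul_right_comm]
      exact Nat.mul_le_mul_right _ (by omega)
    · obtain ⟨q, hq, e⟩ := ih (2 * i + 1)
      refine ⟨q, hq.trans_le ?_, by rw [tree, h, e]⟩
      rw [pow_succ, ← mul_assoc, mul_right_comm]
      exact Nat.mul_le_mul_right _ (by omega)

/-- If a reflexive and transitive relation puts the combination of two words above both of them,
then it puts the value of a node above all the leaves below the node. -/
theorem tree_rel {r : ℕ → ℕ → Prop} (hr : ∀ a, r a a) (ht : ∀ a b d, r a b → r b d → r a d)
    (hl : ∀ a b, r (c a b) a) (hrt : ∀ a b, r (c a b) b) (j i q : ℕ) (h₁ : i * 2 ^ j ≤ q)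
    (h₂ : q < (i + 1) * 2 ^ j) : r (tree c x j i) (x q) := by
  induction j generalizing i with
  | zero =>
    obtain rfl : i = q := by omega
    exact hr _
  | succ j ih =>
    rw [pow_succ] at h₁ h₂
    rw [tree]
    rcases Nat.lt_or_ge q ((2 * i + 1) * 2 ^ j) with h | h
    · exact ht _ _ _ (hl _ _) (ih (2 * i) (by linarith) h)
    · exact ht _ _ _ (hrt _ _) (ih (2 * i + 1) h (by linarith))

end tree

/-- The best choice in a list of `2 ^ L` choices. -/
noncomputable def best (w : ℕ → ℝ) (L : ℕ) (x : ℕ → ℕ) : ℕ := tree (better w) x L 0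

theorem dom_best {w : ℕ → ℝ} {L : ℕ} {x : ℕ → ℕ} {q : ℕ} (hq : q < 2 ^ L) :
    Dom w (best w L x) (x q) := by
  refine tree_rel (r := Dom w) (dom_refl w) (fun _ _ _ => Dom.trans) (fun a b => ?_)
    (fun a b => ?_) L 0 q (by simp) (by simpa using hq)
  · unfold better
    split_ifs with h
    · exact dom_refl w a
    · exact (dom_total w a b).resolve_left h
  · unfold better
    split_ifs with h
    · exact h
    · exact dom_refl w b

theorem exists_best_eq (w : ℕ → ℝ) (L : ℕ) (x : ℕ → ℕ) : ∃ q < 2 ^ L, best w L x = x q := by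
  simpa [best] using exists_tree_eq (c := better w) (x := x)
    (fun a b => by unfold better; split_ifs <;> simp) L 0

/-! ### Tuples of digits coded by words -/

/-- The word with digits `ℓ 0, …, ℓ (k - 1)` in base `b`. -/
def code (b k : ℕ) (ℓ : ℕ → ℕ) : ℕ := ∑ q ∈ Finset.range k, ℓ q * b ^ q

/-- Digit `p` of the word `s` in base `b`. -/
def digit (b s p : ℕ) : ℕ := s / b ^ p % b

theorem code_succ (b k : ℕ) (ℓ : ℕ → ℕ) :
    code b (k + 1) ℓ = ℓ 0 + b * code b k (fun q => ℓ (q + 1)) := by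
  rw [code, code, Finset.sum_range_succ', Finset.mul_sum, add_comm]
  congr 1
  · simp
  · exact Finset.sum_congr rfl fun q _ => by ring

theorem code_lt {b k : ℕ} {ℓ : ℕ → ℕ} (h : ∀ q < k, ℓ q < b) : code b k ℓ < b ^ k := by
  induction k with
  | zero => simp [code]
  | succ k ih =>
    have h₁ := ih fun q hq => h q (by omega)
    rw [code, Finset.sum_range_succ, ← code, pow_succ]
    have : (ℓ k + 1) * b ^ k ≤ b * b ^ k := Nat.mul_le_mul_right _ (h k (by omega))
    linarith

theorem code_le_of_le {b k j : ℕ} {ℓ : ℕ → ℕ} (h : j ≤ k) : code b j ℓ ≤ code b k ℓ :=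
  Finset.sum_le_sum_of_subset (Finset.range_mono h)

theorem digit_code {b k p : ℕ} {ℓ : ℕ → ℕ} (h : ∀ q < k, ℓ q < b) (hp : p < k) :
    digit b (code b k ℓ) p = ℓ p := by
  induction k generalizing ℓ p with
  | zero => omega
  | succ k ih =>
    have h0 := h 0 (by omega)
    rw [code_succ, digit]
    cases p with
    | zero => simp [Nat.mod_eq_of_lt h0]
    | succ p =>
      rw [pow_succ', ← Nat.div_div_eq_div_mul, Nat.add_mul_div_left _ _ (by omega),
        Nat.div_eq_of_lt h0, zero_add]
      exact ih (ℓ := fun q => ℓ (q + 1)) (fun q hq => h _ (by omega)) (by omega)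

theorem code_congr {b k : ℕ} {ℓ ℓ' : ℕ → ℕ} (h : ∀ q < k, ℓ q = ℓ' q) :
    code b k ℓ = code b k ℓ' :=
  Finset.sum_congr rfl fun q hq => by rw [h q (Finset.mem_range.1 hq)]

/-! ### Round Robin on choices -/

section process

variable (u : ℕ → ℕ → ℝ) (L : ℕ) (a : ℕ → ℕ)

/-- The list of the remaining choices at time `t`, if it is `a` at time `0` and at every time `t`
the best choice for the values `u t` is removed. -/
noncomputable def rem : ℕ → ℕ → ℕ
  | 0, g => a g
  | t + 1, g => if rem t g = best (u t) L (rem t) then 0 else rem t g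

/-- The choice at time `t`. -/
noncomputable def pick (t : ℕ) : ℕ := best (u t) L (rem u L a t)

/-- The last choice other than `0` that was made before time `t` at a time congruent to `p` modulo
`k`, and `0` if there is none. -/
noncomputable def last (k : ℕ) : ℕ → ℕ → ℕ
  | 0, _ => 0
  | t + 1, p => if p = t % k ∧ pick u L a t ≠ 0 then pick u L a t else last k t p

variable {u L a}

theorem rem_succ (t g : ℕ) :
    rem u L a (t + 1) g = if rem u L a t g = pick u L a t then 0 else rem u L a t g := rfl

theorem rem_eq_zero_or (h : ∀ g, a g = 0 ∨ a g = g + 1) (t g : ℕ) :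
    rem u L a t g = 0 ∨ rem u L a t g = g + 1 := by
  induction t with
  | zero => exact h g
  | succ t ih => rw [rem_succ]; split_ifs <;> simp [ih]

theorem rem_eq_zero_of_le {t t' g : ℕ} (h : t ≤ t') (h₀ : rem u L a t g = 0) :
    rem u L a t' g = 0 := by
  induction t', h using Nat.le_induction with
  | base => exact h₀
  | succ t' _ ih => rw [rem_succ]; split_ifs <;> simp [ih]

theorem exists_pick_eq (t : ℕ) : ∃ q < 2 ^ L, pick u L a t = rem u L a t q := exists_best_eq _ _ _

/-- The choices from time `t` on are those of a process that starts at time `t`. -/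
theorem rem_add {u' : ℕ → ℕ → ℝ} {t k : ℕ} (hu : ∀ p < k, u (t + p) = u' p) {p : ℕ} (hp : p ≤ k) :
    rem u' L (rem u L a t) p = rem u L a (t + p) := by
  induction p with
  | zero => rfl
  | succ p ih =>
    funext g
    rw [← add_assoc, rem_succ, rem_succ, pick, pick, ih (by omega), hu p (by omega)]

theorem last_eq_zero_or (k t p : ℕ) :
    last u L a k t p = 0 ∨
      ∃ s < t, s % k = p ∧ pick u L a s ≠ 0 ∧ last u L a k t p = pick u L a s := by
  induction t with
  | zero => left; rfl
  | succ t ih =>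
    rw [last]
    split_ifs with h
    · exact Or.inr ⟨t, by omega, h.1.symm, h.2, rfl⟩
    · rcases ih with ih | ⟨s, hs, e⟩
      · exact Or.inl ih
      · exact Or.inr ⟨s, by omega, e⟩

end process

/-- All choices are available in the beginning. -/
def all (m g : ℕ) : ℕ := if g < m then g + 1 else 0

theorem all_eq_zero_or (m g : ℕ) : all m g = 0 ∨ all m g = g + 1 := by
  unfold all; split_ifs <;> simp

section avail

variable (w : ℕ → ℕ → ℝ) (m k L : ℕ)

open Classical in
/-- The choices that are not preferred to `ℓ p` by any of the agents `p < k`, where `ℓ p ≠ 0`. -/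
noncomputable def avail (ℓ : ℕ → ℕ) (g : ℕ) : ℕ :=
  if g < m ∧ ∀ p < k, ℓ p ≠ 0 → ¬ Dom (w p) (g + 1) (ℓ p) then g + 1 else 0

variable {w m k L}

theorem avail_congr {ℓ ℓ' : ℕ → ℕ} (h : ∀ q < k, ℓ q = ℓ' q) :
    avail w m k ℓ = avail w m k ℓ' := by
  funext g
  unfold avail
  congr 1
  simp only [eq_iff_iff]
  refine and_congr_right fun _ => forall_congr' fun p => ?_
  refine forall_congr' fun hp => by rw [h p hp]

/-- The set of the remaining goods is determined by the last choices of the agents: a good has been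
taken exactly if some agent does not prefer its own last choice to it. -/
theorem avail_last (hk : 0 < k) (hL : m ≤ 2 ^ L) (t : ℕ) :
    avail w m k (last (fun t => w (t % k)) L (all m) k t) =
      rem (fun t => w (t % k)) L (all m) t := by
  set u : ℕ → ℕ → ℝ := fun t => w (t % k) with hu
  induction t with
  | zero => funext g; simp [avail, last, rem, all]
  | succ t ih =>
    have ih' : ∀ g, avail w m k (last u L (all m) k t) g = rem u L (all m) t g :=
      fun g => by rw [ih]
    have hbest : ∀ g < m, Dom (w (t % k)) (pick u L (all m) t) (rem u L (all m) t g) :=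
      fun g hg => dom_best (hg.trans_le hL)
    funext g
    rw [rem_succ]
    by_cases hg : g < m
    swap
    -- beyond the goods both sides are `0`
    · have h0 : rem u L (all m) t g = 0 := by rw [← ih']; simp [avail, hg]
      simp [avail, hg, h0]
    by_cases hz : pick u L (all m) t = 0
    -- nothing is left, since the best choice is `0`
    · have h1 : last u L (all m) k (t + 1) = last u L (all m) k t := by
        funext p; simp [last, hz]
      have h2 := hbest g hg
      have h3 : rem u L (all m) t g = 0 := by
        rw [hz] at h2
        simpa [Dom] using h2
      rw [h1, ih', h3, hz]
      simp
    have hlast : ∀ p, last u L (all m) k (t + 1) p =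
        if p = t % k then pick u L (all m) t else last u L (all m) k t p := by
      intro p; simp [last, hz]
    -- the good `g₀` is taken by agent `t % k`
    obtain ⟨g₀, -, hg₀⟩ := exists_pick_eq (u := u) (L := L) (a := all m) t
    have hg₀' : rem u L (all m) t g₀ = g₀ + 1 :=
      (rem_eq_zero_or (all_eq_zero_or m) t g₀).resolve_left (by rw [← hg₀]; exact hz)
    have havail₀ := ih' g₀
    rw [hg₀', avail] at havail₀
    split_ifs at havail₀ with h₀
    rw [hg₀'] at hg₀
    have hp₀ : t % k < k := Nat.mod_lt _ hk
    rw [hg₀] at hbest hlast ⊢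
    rw [← ih' g]
    by_cases hA : ∀ p < k, last u L (all m) k t p ≠ 0 → ¬ Dom (w p) (g + 1) (last u L (all m) k t p)
    · rw [show avail w m k (last u L (all m) k t) g = g + 1 from if_pos ⟨hg, hA⟩]
      have hdom := hbest g hg
      rw [← ih' g, show avail w m k (last u L (all m) k t) g = g + 1 from if_pos ⟨hg, hA⟩] at hdom
      by_cases hgg : g = g₀
      · subst hgg
        rw [if_pos rfl, avail, if_neg]
        intro h
        refine h.2 _ hp₀ ?_ ?_ <;> rw [hlast, if_pos rfl]
        · omega
        · exact dom_refl _ _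
      · rw [if_neg (by omega), avail, if_pos]
        -- a remaining good other than `g₀` is not preferred to `g₀`, by antisymmetry
        refine ⟨hg, fun p hp hne hd => ?_⟩
        rw [hlast] at hne hd
        split_ifs at hne hd with hpt
        · subst hpt
          exact hgg (by simpa using hd.antisymm hdom)
        · exact hA p hp hne hd
    · have h0 : avail w m k (last u L (all m) k t) g = 0 := if_neg fun h => hA h.2
      rw [h0, if_neg (by omega), avail, if_neg]
      rintro ⟨-, h⟩
      refine hA fun p hp hne hd => ?_
      -- a good preferred to the old last choice of agent `t % k` is preferred to `g₀`, because `g₀`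
      -- was available and hence comes after the old choice
      by_cases hpt : p = t % k
      · subst hpt
        refine h _ hp ?_ ?_ <;> rw [hlast, if_pos rfl]
        · omega
        · exact hd.trans ((dom_total _ _ _).resolve_left (h₀.2 _ hp hne))
      · exact h p hp (by rwa [hlast, if_neg hpt]) (by rwa [hlast, if_neg hpt])

end avail

section round

variable (w : ℕ → ℕ → ℝ) (m k L : ℕ)

/-- The last choices after a round that starts with the last choices coded by `s`. -/
noncomputable def newDigit (s p : ℕ) : ℕ :=
  if pick w L (avail w m k (digit (m + 1) s)) p = 0 then digit (m + 1) s p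
  else pick w L (avail w m k (digit (m + 1) s)) p

/-- One round of Round Robin, on codes of last choices. -/
noncomputable def roundMap (s : ℕ) : ℕ := code (m + 1) k (newDigit w m k L s)

variable {w m k L}

theorem rem_le {u : ℕ → ℕ → ℝ} {a : ℕ → ℕ} (ha : ∀ g, a g ≤ m) (t g : ℕ) : rem u L a t g ≤ m := by
  induction t with
  | zero => exact ha g
  | succ t ih => rw [rem_succ]; split_ifs <;> simp [ih]

theorem pick_le {u : ℕ → ℕ → ℝ} {a : ℕ → ℕ} (ha : ∀ g, a g ≤ m) (t : ℕ) : pick u L a t ≤ m := by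
  obtain ⟨q, -, e⟩ := exists_pick_eq (u := u) (L := L) (a := a) t
  rw [e]
  exact rem_le ha t q

theorem avail_le (ℓ : ℕ → ℕ) (g : ℕ) : avail w m k ℓ g ≤ m := by
  unfold avail; split_ifs <;> omega

theorem all_le (g : ℕ) : all m g ≤ m := by
  unfold all; split_ifs <;> omega

theorem newDigit_lt (s p : ℕ) : newDigit w m k L s p < m + 1 := by
  unfold newDigit
  split_ifs
  · exact Nat.mod_lt _ (by omega)
  · exact Nat.lt_succ_of_le (pick_le (avail_le _) _)

theorem roundMap_lt (s : ℕ) : roundMap w m k L s < (m + 1) ^ k :=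
  code_lt fun _ _ => newDigit_lt _ _

theorem last_lt (t p : ℕ) : last (fun t => w (t % k)) L (all m) k t p < m + 1 := by
  rcases last_eq_zero_or (u := fun t => w (t % k)) (L := L) (a := all m) k t p with
    h | ⟨s, -, -, -, h⟩
  · omega
  · rw [h]
    exact Nat.lt_succ_of_le (pick_le all_le _)

/-- During a round, every position changes its last choice at most once. -/
theorem last_round {u : ℕ → ℕ → ℝ} {a : ℕ → ℕ} {r j p : ℕ} (hj : j ≤ k) :
    last u L a k (k * r + j) p =
      if p < j ∧ pick u L a (k * r + p) ≠ 0 then pick u L a (k * r + p)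
      else last u L a k (k * r) p := by
  induction j with
  | zero => simp
  | succ j ih =>
    rw [← add_assoc, last, ih (by omega), Nat.mul_add_mod, Nat.mod_eq_of_lt (by omega)]
    by_cases hpj : p = j
    · subst hpj; simp
    · have : p < j + 1 ↔ p < j := by omega
      simp [hpj, this]

/-- The round map performs round `r` of Round Robin on the codes of the last choices. -/
theorem roundMap_code_last (hk : 0 < k) (hL : m ≤ 2 ^ L) (r : ℕ) :
    roundMap w m k L (code (m + 1) k (last (fun t => w (t % k)) L (all m) k (k * r))) =
      code (m + 1) k (last (fun t => w (t % k)) L (all m) k (k * (r + 1))) := by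
  refine code_congr fun p hp => ?_
  have hd : ∀ q < k, digit (m + 1)
      (code (m + 1) k (last (fun t => w (t % k)) L (all m) k (k * r))) q =
      last (fun t => w (t % k)) L (all m) k (k * r) q :=
    fun q hq => digit_code (fun q _ => last_lt _ _) hq
  have hu : ∀ q < k, (fun t => w (t % k)) (k * r + q) = w q := fun q hq => by
    simp [Nat.mod_eq_of_lt hq]
  have hpick : pick w L (rem (fun t => w (t % k)) L (all m) (k * r)) p =
      pick (fun t => w (t % k)) L (all m) (k * r + p) := by
    rw [pick, pick, rem_add hu hp.le]
    exact congrArg (fun v => best v L _) (hu p hp).symm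
  rw [newDigit, hd p hp, avail_congr hd, avail_last hk hL, mul_add, mul_one,
    last_round le_rfl, hpick]
  by_cases h : pick (fun t => w (t % k)) L (all m) (k * r + p) = 0 <;> simp [h, hp]

theorem iterate_roundMap (hk : 0 < k) (hL : m ≤ 2 ^ L) (r : ℕ) :
    (roundMap w m k L)^[r] 0 =
      code (m + 1) k (last (fun t => w (t % k)) L (all m) k (k * r)) := by
  induction r with
  | zero => simp [code, last]
  | succ r ih => rw [Function.iterate_succ_apply', ih, roundMap_code_last hk hL]

end round

/-! ### The choices of Round Robin enumerate the goods -/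

section enumerate

variable {u : ℕ → ℕ → ℝ} {m L : ℕ}

theorem rem_of_pick_eq {t g : ℕ} (h : pick u L (all m) t = g + 1) :
    rem u L (all m) t g = g + 1 := by
  obtain ⟨q, -, e⟩ := exists_pick_eq (u := u) (L := L) (a := all m) t
  rcases rem_eq_zero_or (u := u) (L := L) (all_eq_zero_or m) t q with h' | h'
  · omega
  · obtain rfl : q = g := by omega
    exact h'

theorem rem_eq_zero_of_lt {t s g : ℕ} (hts : t < s) (h : pick u L (all m) t = g + 1) :
    rem u L (all m) s g = 0 :=
  rem_eq_zero_of_le hts (by rw [rem_succ, rem_of_pick_eq h, h, if_pos rfl])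

theorem pick_inj {t s g : ℕ} (h₁ : pick u L (all m) t = g + 1) (h₂ : pick u L (all m) s = g + 1) :
    t = s := by
  by_contra hne
  rcases Nat.lt_or_gt_of_ne hne with h | h
  · have := rem_eq_zero_of_lt h h₁
    rw [rem_of_pick_eq h₂] at this
    omega
  · have := rem_eq_zero_of_lt h h₂
    rw [rem_of_pick_eq h₁] at this
    omega

/-- At each time at most one good is removed, so that a good is left before time `m`. -/
theorem pick_ne_zero (hL : m ≤ 2 ^ L) {t : ℕ} (ht : t < m) : pick u L (all m) t ≠ 0 := by
  -- at least `m - t` goods are left at time `t`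
  have hcard : ∀ t, m ≤ ((Finset.range m).filter fun g => rem u L (all m) t g ≠ 0).card + t := by
    intro t
    induction t with
    | zero =>
      rw [Finset.filter_true_of_mem]
      · simp
      · intro g hg
        simp [rem, all, Finset.mem_range.1 hg]
    | succ t ih =>
      have hsub : ((Finset.range m).filter fun g => rem u L (all m) t g ≠ 0) ⊆
          insert (pick u L (all m) t - 1)
            ((Finset.range m).filter fun g => rem u L (all m) (t + 1) g ≠ 0) := by
        intro g hg
        rw [Finset.mem_filter] at hg
        rw [Finset.mem_insert, Finset.mem_filter]
        by_cases h : rem u L (all m) t g = pick u L (all m) t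
        · left
          rw [← h, (rem_eq_zero_or (all_eq_zero_or m) t g).resolve_left hg.2]
          rfl
        · right
          rw [rem_succ, if_neg h]
          exact hg
      have := (Finset.card_le_card hsub).trans (Finset.card_insert_le _ _)
      omega
  intro h0
  have h := hcard t
  rw [Finset.filter_false_of_mem] at h
  · simp at h
    omega
  · intro g hg
    have hd : Dom (u t) (pick u L (all m) t) (rem u L (all m) t g) :=
      dom_best ((Finset.mem_range.1 hg).trans_le hL)
    rw [h0] at hd
    simpa [Dom] using hd

/-- The good that is taken at time `t`. -/
noncomputable def pickFin (u : ℕ → ℕ → ℝ) (L : ℕ) (hL : m ≤ 2 ^ L) (t : Fin m) : Fin m :=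
  ⟨pick u L (all m) t - 1, by
    have h1 := pick_le (u := u) (L := L) (all_le (m := m)) t
    have h2 := pick_ne_zero (u := u) hL t.2
    omega⟩

theorem pick_eq (hL : m ≤ 2 ^ L) (t : Fin m) :
    pick u L (all m) t = (pickFin u L hL t : ℕ) + 1 := by
  have h2 := pick_ne_zero (u := u) hL t.2
  simp only [pickFin]
  omega

theorem pickFin_bijective (hL : m ≤ 2 ^ L) : Function.Bijective (pickFin u L hL) := by
  refine Finite.injective_iff_bijective.1 fun t s h => Fin.ext ?_
  exact pick_inj (pick_eq hL t) (by rw [pick_eq hL s, h])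

theorem pickFin_best (hL : m ≤ 2 ^ L) {t s : Fin m} (hts : t ≤ s) :
    u t (pickFin u L hL s) ≤ u t (pickFin u L hL t) := by
  have hs := rem_of_pick_eq (pick_eq (u := u) hL s)
  have ht : rem u L (all m) t (pickFin u L hL s) = (pickFin u L hL s : ℕ) + 1 := by
    refine (rem_eq_zero_or (all_eq_zero_or m) t _).resolve_left fun h => ?_
    rw [rem_eq_zero_of_le hts h] at hs
    omega
  have hd : Dom (u t) (pick u L (all m) t) (rem u L (all m) t (pickFin u L hL s)) :=
    dom_best ((pickFin u L hL s).2.trans_le hL)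
  rw [ht, pick_eq hL] at hd
  exact hd.le

end enumerate

/-! ### Reading off the owner of a good -/

section owner

variable (w : ℕ → ℕ → ℝ) (m k L : ℕ)

/-- The entry `q` of the list in which the position of the owner of the good `g` is looked up: it is
`p + 1` if `q` encodes a number of rounds after which `g` is the last choice at position `p`. -/
noncomputable def trace (g q : ℕ) : ℕ :=
  if q < 2 ^ L * k then
    if digit (m + 1) ((roundMap w m k L)^[q / k] 0) (q % k) = g + 1 then q % k + 1 else 0
  else 0

/-- The position of the owner of the good `g`, plus `1`. -/
noncomputable def ownerPos (g : ℕ) : ℕ := tree firstNonzero (trace w m k L g) (2 * L) 0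

variable {w m k L}

/-- A good is the last choice at a position after some number of rounds only if it was taken at this
position, and it is the last choice after the round in which it is taken. -/
theorem ownerPos_pick (hk : 0 < k) (hkm : k ≤ m) (hL : m < 2 ^ L) {t : ℕ} (ht : t < m) {g : ℕ}
    (hg : pick (fun t => w (t % k)) L (all m) t = g + 1) :
    ownerPos w m k L g = t % k + 1 := by
  have hdig : ∀ q, digit (m + 1) ((roundMap w m k L)^[q / k] 0) (q % k) =
      last (fun t => w (t % k)) L (all m) k (k * (q / k)) (q % k) := fun q => by
    rw [iterate_roundMap hk hL.le, digit_code (fun _ _ => last_lt _ _) (Nat.mod_lt _ hk)]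
  -- an entry other than `0` gives the right position
  have hone : ∀ q, trace w m k L g q = 0 ∨ trace w m k L g q = t % k + 1 := by
    intro q
    unfold trace
    split_ifs with h1 h2 <;> try exact Or.inl rfl
    right
    rw [hdig] at h2
    rcases last_eq_zero_or (u := fun t => w (t % k)) (L := L) (a := all m) k (k * (q / k)) (q % k)
      with h | ⟨s, -, hs, -, h⟩
    · omega
    · rw [← hs, pick_inj hg (by rw [← h, h2])]
  -- after the round that contains time `t`, the choice at time `t` is the last one at its position
  have hrange : (t / k + 1) * k + t % k < 2 ^ L * k := by
    have : t / k < m := (Nat.div_le_self _ _).trans_lt ht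
    have h2 : (t / k + 1 + 1) * k ≤ 2 ^ L * k := Nat.mul_le_mul_right _ (by omega)
    have := Nat.mod_lt t hk
    linarith
  have hne : trace w m k L g ((t / k + 1) * k + t % k) ≠ 0 := by
    have e1 : ((t / k + 1) * k + t % k) / k = t / k + 1 := by
      rw [mul_comm, Nat.mul_add_div hk, Nat.div_eq_of_lt (Nat.mod_lt _ hk), add_zero]
    have e2 : ((t / k + 1) * k + t % k) % k = t % k := by
      rw [mul_comm, Nat.mul_add_mod, Nat.mod_mod]
    have e3 : last (fun t => w (t % k)) L (all m) k (k * (t / k + 1)) (t % k) = g + 1 := by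
      rw [mul_add, mul_one, last_round le_rfl, Nat.div_add_mod, hg]
      simp [Nat.mod_lt _ hk]
    have := hdig ((t / k + 1) * k + t % k)
    rw [e1, e2, e3] at this
    rw [trace, if_pos hrange, e1, e2, if_pos this]
    omega
  -- a tree of height `2 * L` has enough leaves for the whole list, as `k ≤ m < 2 ^ L`
  have hpow : 2 ^ L * k ≤ 2 ^ (2 * L) := by
    rw [two_mul, pow_add]
    exact Nat.mul_le_mul_left _ (by omega)
  obtain ⟨q, -, hq⟩ := exists_tree_eq (c := firstNonzero) (x := trace w m k L g)
    (fun a b => by unfold firstNonzero; split_ifs <;> simp) (2 * L) 0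
  have hr := tree_rel (c := firstNonzero) (x := trace w m k L g) (r := fun a b => a = 0 → b = 0)
    (fun _ => id) (fun _ _ _ f g h => g (f h))
    (fun a b => by unfold firstNonzero; split_ifs <;> simp_all)
    (fun a b => by unfold firstNonzero; split_ifs <;> simp_all) (2 * L) 0
    ((t / k + 1) * k + t % k) (by simp) (by linarith)
  rw [ownerPos]
  rcases hone q with h | h
  · exact absurd (hr (hq.trans h)) hne
  · rw [hq, h]

theorem better_zero_zero (w : ℕ → ℝ) : better w 0 0 = 0 := by simp [better]

end owner

end RoundRobin

namespace OrderedInstance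

variable (I : OrderedInstance)

/-! ### Round Robin with a fixed order is envy-free up to one good -/

theorem turn_eq_iff (τ : Equiv.Perm (Fin I.n)) {t : ℕ} {i : Fin I.n} :
    I.turn (fun _ => τ) t = i ↔ t % I.n = (τ.symm i : ℕ) := by
  rw [turn, ← Equiv.eq_symm_apply, Fin.ext_iff]

/-- Every good of agent `j`, except the one of the first round, is worth to agent `i` at most as
much as the good that `i` took the last time before. -/
theorem IsFixedOrderRoundRobin.isEF1 {A : I.Allocation} (hA : I.IsFixedOrderRoundRobin A) :
    I.IsEF1 A := by
  obtain ⟨π, hπ⟩ := hA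
  intro i j hne
  have hn := I.n_pos
  set pi : ℕ := (I.σ.symm i : ℕ) with hpi
  set pj : ℕ := (I.σ.symm j : ℕ) with hpj
  have hpi' : pi < I.n := (I.σ.symm i).2
  have hpj' : pj < I.n := (I.σ.symm j).2
  have hmem : ∀ (a : Fin I.n) g, g ∈ I.bundle A a ↔ (π.symm g : ℕ) % I.n = (I.σ.symm a : ℕ) := by
    intro a g
    have h1 := (hπ (π.symm g)).1
    rw [Equiv.apply_symm_apply] at h1
    rw [bundle, Finset.mem_filter, h1, turn_eq_iff]
    simp
  -- the good of agent `j` in the first round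
  obtain ⟨g', hg'⟩ := hne
  have hpjm : pj < I.m := by
    have := (hmem j g').1 hg'
    have h2 := Nat.mod_le (π.symm g' : ℕ) I.n
    have := (π.symm g').2
    omega
  refine ⟨π ⟨pj, hpjm⟩, ?_, ?_⟩
  · rw [hmem, Equiv.symm_apply_apply]
    exact Nat.mod_eq_of_lt hpj'
  -- the number of turns since the last turn of agent `i`
  set d : ℕ := (pj + I.n - pi) % I.n with hd
  have hd' : d < I.n := Nat.mod_lt _ hn
  have hlate : ∀ g ∈ I.bundle A j \ {π ⟨pj, hpjm⟩}, I.n ≤ (π.symm g : ℕ) := by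
    intro g hg
    rw [Finset.mem_sdiff, Finset.mem_singleton, hmem] at hg
    by_contra hlt
    rw [Nat.mod_eq_of_lt (by omega)] at hg
    exact hg.2 (by rw [← Equiv.symm_apply_eq]; exact Fin.ext hg.1)
  let φ : Fin I.m → Fin I.m := fun g => π ⟨(π.symm g : ℕ) - d, by have := (π.symm g).2; omega⟩
  have hφ : ∀ g ∈ I.bundle A j \ {π ⟨pj, hpjm⟩}, φ g ∈ I.bundle A i ∧ I.v i g ≤ I.v i (φ g) := by
    intro g hg
    have hl := hlate g hg
    have h1 := (hmem j g).1 (Finset.mem_sdiff.1 hg).1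
    have h2 : ((π.symm g : ℕ) - d) % I.n = pi := by
      have e : ((π.symm g : ℕ) - d + d) % I.n = pj := by rwa [Nat.sub_add_cancel (by omega)]
      have e2 : (pi + d) % I.n = pj := by
        rw [hd, Nat.add_mod_mod, show pi + (pj + I.n - pi) = pj + I.n by omega,
          Nat.add_mod_right, Nat.mod_eq_of_lt hpj']
      have e3 : (π.symm g : ℕ) - d ≡ pi [MOD I.n] := Nat.ModEq.add_right_cancel' d (e.trans e2.symm)
      rw [e3, Nat.mod_eq_of_lt hpi']
    have h3 : φ g ∈ I.bundle A i := by
      rw [hmem]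
      simpa [φ] using h2
    refine ⟨h3, ?_⟩
    have h4 := (hπ ⟨(π.symm g : ℕ) - d, by have := (π.symm g).2; omega⟩).2 (π.symm g)
      (by rw [Fin.le_def]; exact Nat.sub_le _ _)
    rw [(turn_eq_iff I I.σ).2 h2, Equiv.apply_symm_apply] at h4
    exact h4
  calc I.value i (I.bundle A j \ {π ⟨pj, hpjm⟩})
      ≤ ∑ g ∈ I.bundle A j \ {π ⟨pj, hpjm⟩}, I.v i (φ g) :=
        Finset.sum_le_sum fun g hg => (hφ g hg).2
    _ = ∑ g ∈ (I.bundle A j \ {π ⟨pj, hpjm⟩}).image φ, I.v i g := by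
        rw [Finset.sum_image]
        intro g hg h hh e
        have hg' := hlate g hg
        have hh' := hlate h hh
        have e' := congrArg Fin.val (π.injective e)
        dsimp only at e'
        exact π.symm.injective (Fin.ext (by omega))
    _ ≤ I.value i (I.bundle A i) := by
        refine Finset.sum_le_sum_of_subset fun g hg => ?_
        obtain ⟨h, hh, rfl⟩ := Finset.mem_image.1 hg
        exact (hφ h hh).1

/-! ### Instances as data -/

/-- The value of a good for an agent, and `0` if there is no such agent or no such good. -/
def valueAt (a g : ℕ) : ℝ := if h : a < I.n ∧ g < I.m then I.v ⟨a, h.1⟩ ⟨g, h.2⟩ else 0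

/-- The agent at a position, and `0` if there is no such position. -/
def agentAt (p : ℕ) : ℕ := if h : p < I.n then I.σ ⟨p, h⟩ else 0

theorem agentAt_lt {p : ℕ} (h : p < I.n) : I.agentAt p < I.n := by
  rw [agentAt, dif_pos h]
  exact Fin.is_lt _

open ForkJoin in
theorem encode_eq : I.encode =
    .pair (.tabulate I.n fun a => .tabulate I.m fun g => .real (I.valueAt a g))
      (.tabulate I.n fun p => .nat (I.agentAt p)) := by
  simp [encode, Val.tabulate, valueAt, agentAt]

open RoundRobin in
/-- The list of owners that is read off from the iterated round maps is a solution. At most `m`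
agents take part, since there are no more than `m` turns. -/
theorem solves_owner {L : ℕ} (hL : I.m < 2 ^ L) :
    I.Solves (.tabulate I.m fun g => .nat (I.agentAt
      (ownerPos (fun p => I.valueAt (I.agentAt p)) I.m (min I.n I.m) L g - 1))) := by
  set w : ℕ → ℕ → ℝ := fun p => I.valueAt (I.agentAt p) with hw
  set k := min I.n I.m with hk
  have hn := I.n_pos
  set u : ℕ → ℕ → ℝ := fun t => w (t % k) with hu
  have hmod : ∀ t < I.m, t % k = t % I.n := by
    intro t ht
    rcases Nat.le_total I.n I.m with h | h
    · rw [hk, min_eq_left h]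
    · rw [hk, min_eq_right h, Nat.mod_eq_of_lt ht, Nat.mod_eq_of_lt (ht.trans_le h)]
  let π : Equiv.Perm (Fin I.m) := Equiv.ofBijective _ (pickFin_bijective (u := u) hL.le)
  let A : I.Allocation := fun g => I.turn (fun _ => I.σ) (π.symm g)
  have hagent : ∀ t < I.m, I.agentAt (t % k) = I.turn (fun _ => I.σ) t := by
    intro t ht
    rw [hmod t ht, agentAt, dif_pos (Nat.mod_lt _ hn), turn]
  have hRR : I.IsFixedOrderRoundRobin A := by
    refine ⟨π, fun t => ⟨by simp [A], fun s hts => ?_⟩⟩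
    have h := pickFin_best (u := u) hL.le hts
    have hval : ∀ g : Fin I.m, u t g = I.v (I.turn (fun _ => I.σ) t) g := by
      intro g
      simp only [hu, hw]
      rw [hagent t t.2, valueAt, dif_pos ⟨Fin.is_lt _, g.2⟩]
    rw [hval, hval] at h
    exact_mod_cast h
  refine ⟨A, ?_, hRR, hRR.isEF1⟩
  simp only [ForkJoin.Val.tabulate, encodeAllocation]
  congr 1
  funext g
  have hm : 0 < I.m := g.pos
  have hg : pick u L (all I.m) (π.symm g) = (g : ℕ) + 1 := by
    rw [pick_eq hL.le]
    congr 2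
    exact π.apply_symm_apply g
  rw [ownerPos_pick (lt_min hn hm) (min_le_right _ _) hL (π.symm g).2 hg, Nat.add_sub_cancel,
    hagent _ (π.symm g).2]

end OrderedInstance

namespace RoundRobin

open ForkJoin Prog

/-! ### Building blocks of the program -/

/-- Digit `p` of the word `s` in base `m + 1`, if `pw` is the list of the powers of the base. -/
def digitProg (m pw s p : Prog) : Prog :=
  .op .mod (.op .div s (.get pw p)) (.op .add m (.const 1))

/-- Whether agent `a` prefers the choice `x` to the choice `y`, if `V` is the table of values. -/
def domProg (V a x y : Prog) : Prog :=
  .ite (.op .eq y (.const 0)) (.const 1) <|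
  .ite (.op .eq x (.const 0)) (.const 0) <|
  .ite (.op .le x y)
    (.op .le (.get (.get V a) (.op .sub y (.const 1))) (.get (.get V a) (.op .sub x (.const 1))))
    (.op .sub (.const 1)
      (.op .le (.get (.get V a) (.op .sub x (.const 1)))
        (.get (.get V a) (.op .sub y (.const 1)))))

/-- The root of the tree of height `T` over the array `A`. The two children of a node are variables
`1` and `0` of `body`, behind which three further variables precede those of `A` and `T`. -/
def treeProg (A T body : Prog) : Prog :=
  .get (.loop T A (.const 1)
    (.tab (.op .div (.op .add (.len (.var 0)) (.const 1)) (.const 2))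
      (.letIn (.get (.var 1) (.op .mul (.const 2) (.var 0)))
        (.letIn (.get (.var 2) (.op .add (.op .mul (.const 2) (.var 1)) (.const 1))) body))))
    (.const 0)

section blocks

variable {ρ : List Val} {n m k B : ℕ} {val : ℕ → ℕ → ℝ}

/-- The table of values as a datum. -/
def valueTable (n m : ℕ) (val : ℕ → ℕ → ℝ) : Val :=
  .tabulate n fun a => .tabulate m fun g => .real (val a g)

/-- An array of words. -/
def words (k : ℕ) (f : ℕ → ℕ) : Val := .tabulate k fun i => .nat (f i)

theorem runs_digitProg {pm pw ps pp : Prog} {s p W₁ W₂ D₁ D₂ : ℕ}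
    (hm : Runs pm ρ (.nat m) 1 1 B)
    (hpw : Runs pw ρ (words (k + 1) fun i => (m + 1) ^ i) 1 1 B)
    (hs : Runs ps ρ (.nat s) W₁ D₁ B) (hp : Runs pp ρ (.nat p) W₂ D₂ B) (hpk : p ≤ k)
    (hsB : s ≤ B) (hmB : m + 1 ≤ B) :
    Runs (digitProg pm pw ps pp) ρ (.nat (digit (m + 1) s p)) (W₁ + W₂ + 7) (D₁ + D₂ + 7) B := by
  refine Runs.mono (((hs.div (hpw.get hp (by omega)) hsB).mod
    (hm.add (Runs.const (by omega)) hmB) ?_)) (by omega) (by omega)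
  exact (Nat.div_le_self _ _).trans hsB

open Classical in
theorem runs_domProg {pV pa px py : Prog} {a x y : ℕ}
    (hV : Runs pV ρ (valueTable n m val) 1 1 B) (ha : Runs pa ρ (.nat a) 1 1 B)
    (hx : Runs px ρ (.nat x) 1 1 B) (hy : Runs py ρ (.nat y) 1 1 B) (han : a < n) (hxm : x ≤ m)
    (hym : y ≤ m) (hmB : m + 1 ≤ B) :
    Runs (domProg pV pa px py) ρ (.nat (if Dom (val a) x y then 1 else 0)) 30 30 B := by
  have h1 : 1 ≤ B := by omega
  have hget : ∀ {pz : Prog} {z : ℕ}, Runs pz ρ (.nat z) 1 1 B → z ≤ m → z ≠ 0 →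
      Runs (.get (.get pV pa) (.op .sub pz (.const 1))) ρ (.real (val a (z - 1))) 7 7 B := by
    intro pz z hz hzm hz0
    exact Runs.get (Runs.get hV ha han) (hz.sub (Runs.const h1) (by omega)) (by omega)
  have hC : y ≠ 0 → x ≠ 0 → Runs _ ρ (.nat (if Dom (val a) x y then 1 else 0)) _ _ B :=
    fun hy0 hx0 => Runs.ite (hx.le hy h1)
      (fun h => ((hget hy hym hy0).leReal (hget hx hxm hx0) h1).congr (by
        have hxy : x ≤ y := by by_contra h'; simp [h'] at h
        simp [Dom, hy0, hx0, hxy]))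
      (fun h => ((Runs.const h1).sub ((hget hx hxm hx0).leReal (hget hy hym hy0) h1) h1).congr (by
        have hxy : ¬ x ≤ y := by intro h'; simp [h'] at h
        simp only [Dom, hy0, hx0, hxy, if_false, false_or, ne_eq, not_false_eq_true, true_and,
          ← not_le]
        split_ifs <;> rfl))
  refine Runs.mono (Runs.ite (hy.eq (Runs.const (Nat.zero_le _)) h1)
    (fun h => (Runs.const h1).congr ?_)
    (fun h => Runs.ite (hx.eq (Runs.const (Nat.zero_le _)) h1)
      (fun h' => (Runs.const (Nat.zero_le _)).congr ?_) (fun h' => hC ?_ ?_)))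
    (by norm_num) (by norm_num)
  · have : y = 0 := by by_contra h'; simp [h'] at h
    simp [Dom, this]
  · have : x = 0 := by by_contra h''; simp [h''] at h'
    have : y ≠ 0 := by intro h''; simp [h''] at h
    simp [Dom, *]
  · intro h''; simp [h''] at h
  · intro h''; simp [h''] at h'

/-- A tree over `l` leaves takes work `O(l)` because its levels shrink geometrically, and depth
`O(log² l)` because each level is a parallel loop of its own. -/
theorem runs_treeProg {A pT body : Prog} {c : ℕ → ℕ → ℕ} {x : ℕ → ℕ}
    {l T M L Wa Da Wt Dt Wc Dc : ℕ} (hA : Runs A ρ (words l x) Wa Da B)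
    (hT : Runs pT ρ (.nat T) Wt Dt B) (hc : c 0 0 = 0) (hx : ∀ i, l ≤ i → x i = 0)
    (hcs : ∀ a b, c a b = a ∨ c a b = b) (hxM : ∀ i, x i ≤ M) (hl : l + 2 ≤ B) (hL : l ≤ 2 ^ L)
    (hbody : ∀ a b i st j, a ≤ M → b ≤ M →
      Runs body (.nat b :: .nat a :: i :: st :: j :: ρ) (.nat (c a b)) Wc Dc B) :
    Runs (treeProg A pT body) ρ (.nat (tree c x T 0)) (Wa + Wt + (l + T) * (Wc + 24) + 5)
      (Da + Dt + T * (Dc + L + 23) + 5) B := by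
  have hM : ∀ j i, tree c x j i ≤ M := fun j i => by
    obtain ⟨q, -, e⟩ := exists_tree_eq (x := x) hcs j i
    rw [e]; exact hxM q
  have hget : ∀ j i, (words (treeLen l j) (tree c x j)).get i = .nat (tree c x j i) := by
    intro j i
    rcases Nat.lt_or_ge i (treeLen l j) with h | h
    · exact Val.get_tabulate _ h
    · rw [tree_eq_zero hc hx j i h]
      exact Val.get_tabulate_of_le _ h
  have hloop := Runs.forLoop (s := fun j => words (treeLen l j) (tree c x j)) (k := T)
    (Db := Dc + L + 21) (e := pT) (a := A)
    (b := .tab (.op .div (.op .add (.len (.var 0)) (.const 1)) (.const 2))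
      (.letIn (.get (.var 1) (.op .mul (.const 2) (.var 0)))
        (.letIn (.get (.var 2) (.op .add (.op .mul (.const 2) (.var 1)) (.const 1))) body)))
    (fun j => treeLen l (j + 1) * (Wc + 15) + 7) hT hA (by omega) (fun j _ => by
      have hlen := treeLen_le l j
      have hlen' := treeLen_le l (j + 1)
      have hsucc : treeLen l (j + 1) = (treeLen l j + 1) / 2 := rfl
      refine Runs.mono (Runs.tab (f := fun i => .nat (tree c x (j + 1) i))
        (((Runs.len (f := fun i => .nat (tree c x j i)) (Runs.var rfl) (by omega)).add
          (Runs.const (by omega)) (by omega)).div (Runs.const (by omega)) (by omega))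
        (fun i hi => Runs.letIn
          (Runs.get' (Runs.var rfl) ((Runs.const (by omega)).mul (Runs.var rfl) (by omega))
            (hget j _))
          (Runs.letIn (Runs.get' (Runs.var rfl) (((Runs.const (by omega)).mul (Runs.var rfl)
            (by omega)).add (Runs.const (by omega)) (by omega)) (hget j _))
            (hbody _ _ _ _ _ (hM _ _) (hM _ _))))) ?_ ?_
      · rw [treeLen]
        linarith
      · have : Nat.clog 2 (treeLen l (j + 1)) ≤ L :=
          Nat.clog_le_of_le_pow (by omega)
        omega)
  refine (Runs.get' hloop (Runs.const (Nat.zero_le _)) (hget T 0)).mono ?_ ?_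
  · have h := sum_treeLen_le l T
    have h2 : ∑ j ∈ Finset.range T, (treeLen l (j + 1) * (Wc + 15) + 7 + 2) =
        (∑ j ∈ Finset.range T, treeLen l (j + 1)) * (Wc + 15) + T * 9 := by
      simp only [add_assoc, Finset.sum_add_distrib, Finset.sum_mul, Finset.sum_const,
        Finset.card_range, smul_eq_mul]
      ring
    rw [h2]
    have h3 := Nat.mul_le_mul_right (Wc + 15) h
    have h4 : (l + T) * (Wc + 24) = (l + T) * (Wc + 15) + l * 9 + T * 9 := by ring
    omega
  · rw [show Dc + L + 21 + 2 = Dc + L + 23 by omega]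
    omega

end blocks

/-! ### The program for one round -/

/-- The goods that remain before a round, on the variables `s :: globals`. -/
def availProg : Prog :=
  .tab (.var 4) <| .loop (.var 4) (.op .add (.var 0) (.const 1)) (.const 1) <|
    .letIn (digitProg (.var 7) (.var 4) (.var 3) (.var 1)) <|
    .ite (.op .eq (.var 0) (.const 0)) (.var 1) <|
    .letIn (.get (.var 9) (.var 2)) <|
    .letIn (.op .add (.var 4) (.const 1)) <|
    .ite (domProg (.var 12) (.var 1) (.var 0) (.var 2)) (.const 0) (.var 3)

/-- One choice of a round: the state is the pair of the remaining choices and of the part of the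
code of the new last choices that is known. -/
def pickProg : Prog :=
  .letIn (.get (.var 7) (.var 1)) <|
  .letIn (treeProg (.fst (.var 1)) (.var 5)
    (.ite (domProg (.var 14) (.var 5) (.var 1) (.var 0)) (.var 1) (.var 0))) <|
  .par
    (.tab (.var 8) <| .letIn (.get (.fst (.var 3)) (.var 0)) <|
      .ite (.op .eq (.var 0) (.var 2)) (.const 0) (.var 0))
    (.op .add (.snd (.var 2)) <| .op .mul
      (.ite (.var 0) (.var 0) (digitProg (.var 8) (.var 5) (.var 4) (.var 3)))
      (.get (.var 5) (.var 3)))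

/-- The round map, on the variables `s :: globals`. -/
def roundProg : Prog :=
  .snd <| .loop (.var 3) (.par availProg (.const 0)) (.const 1) pickProg

/-- The parameters of a run: `n` agents, `m` goods, `k` agents that take part, trees of height `L`,
and words that are at most `B`. -/
structure Sizes (n m k L B : ℕ) : Prop where
  k_le_n : k ≤ n
  k_le_m : k ≤ m
  lt_pow : m < 2 ^ L
  L_le : L ≤ m
  m_le : m + 2 ≤ B
  n_le : n ≤ B
  states_le : (m + 1) ^ k ≤ B
  trace_le : 2 ^ L * k + 2 ≤ B
  pow_le : 2 ^ L ≤ B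
  double_le : 2 * L ≤ B
  pow_le_double : 2 ^ L ≤ 2 * (m + 1)
  le_states : m + 1 ≤ (m + 1) ^ k

/-- The variables that are bound before the rounds: the powers of the base `m + 1`, the numbers
`L`, `k` and `m`, the list of the agents, the table of values, and the input. -/
def globals (n m k L : ℕ) (val : ℕ → ℕ → ℝ) (ord : ℕ → ℕ) (inp : Val) : List Val :=
  [words (k + 1) fun i => (m + 1) ^ i, .nat L, .nat k, .nat m, words n ord, valueTable n m val, inp]

variable {n m k L B : ℕ} {val : ℕ → ℕ → ℝ} {ord : ℕ → ℕ} {inp : Val}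

theorem avail_eq_zero {w : ℕ → ℕ → ℝ} {ℓ : ℕ → ℕ} {g : ℕ} (h : m ≤ g) : avail w m k ℓ g = 0 :=
  if_neg fun h' => absurd h'.1 (by omega)

open Classical in
/-- The remaining goods as the result of a sequential loop over the agents. -/
theorem avail_succ (w : ℕ → ℕ → ℝ) (ℓ : ℕ → ℕ) (p g : ℕ) :
    avail w m (p + 1) ℓ g =
      if ℓ p ≠ 0 ∧ Dom (w p) (g + 1) (ℓ p) then 0 else avail w m p ℓ g := by
  by_cases h : ℓ p ≠ 0 ∧ Dom (w p) (g + 1) (ℓ p)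
  · rw [if_pos h, avail, if_neg]
    exact fun h' => h'.2 p (by omega) h.1 h.2
  · rw [if_neg h, avail, avail]
    refine if_congr (and_congr_right fun _ => ⟨fun h' q hq => h' q (by omega), fun h' q hq => ?_⟩)
      rfl rfl
    rcases Nat.lt_succ_iff_lt_or_eq.1 hq with hq | rfl
    · exact h' q hq
    · exact fun h1 h2 => h ⟨h1, h2⟩

theorem Sizes.clog_le (hS : Sizes n m k L B) : Nat.clog 2 m ≤ L :=
  Nat.clog_le_of_le_pow hS.lt_pow.le

theorem runs_availProg (hS : Sizes n m k L B) (hord : ∀ p < n, ord p < n) {s : ℕ}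
    (hs : s ≤ B) :
    Runs availProg (.nat s :: globals n m k L val ord inp)
      (words m (avail (fun p => val (ord p)) m k (digit (m + 1) s)))
      (m * (62 * k + 8) + 2) (62 * k + L + 9) B := by
  have hm := hS.m_le
  have hkn := hS.k_le_n
  have hclog := hS.clog_le
  refine Runs.mono (W₁ := 1 + m * (62 * k + 7) + m + 1)
    (D₁ := 1 + (62 * k + 7) + Nat.clog 2 m + 1)
    (Runs.tab (f := fun g => .nat (avail (fun p => val (ord p)) m k (digit (m + 1) s) g))
      (Runs.var rfl) fun g hg => ?_) (by linarith) (by omega)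
  have hav : ∀ p, avail (fun p => val (ord p)) m p (digit (m + 1) s) g ≤ m :=
    fun p => avail_le _ _
  refine (Runs.forLoop (k := k)
    (s := fun p => .nat (avail (fun p => val (ord p)) m p (digit (m + 1) s) g)) (Db := 60)
    (fun _ => 60) (Runs.var rfl) (((Runs.var rfl).add (Runs.const (by omega)) (by omega)).congr ?_)
    (by omega) (fun p hp => ?_)).mono ?_ ?_
  · simp [avail, hg]
  · have hd : digit (m + 1) s p ≤ m := Nat.le_of_lt_succ (Nat.mod_lt _ (by omega))
    refine Runs.mono (Runs.letIn
      (runs_digitProg (m := m) (k := k) (s := s) (p := p) (Runs.var rfl) (Runs.var rfl)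
        (Runs.var rfl) (Runs.var rfl) hp.le hs (by omega))
      (Runs.ite ((Runs.var rfl).eq (Runs.const (Nat.zero_le _)) (by omega))
        (fun h => (Runs.var rfl).congr ?_)
        (fun h => Runs.letIn (Runs.get (k := n) (f := fun i => .nat (ord i)) (Runs.var rfl)
            (Runs.var rfl) (by omega : p < n))
          (Runs.letIn ((Runs.var rfl).add (Runs.const (by omega)) (by omega : g + 1 ≤ B))
            (Runs.ite (runs_domProg (n := n) (m := m) (val := val) (Runs.var rfl) (Runs.var rfl)
              (Runs.var rfl) (Runs.var rfl) (hord p (by omega)) hg hd (by omega))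
            (fun h' => (Runs.const (Nat.zero_le _)).congr ?_)
            (fun h' => (Runs.var rfl).congr ?_)))))) (by norm_num) (by norm_num)
    · have h0 : digit (m + 1) s p = 0 := by by_contra h'; simp [h'] at h
      rw [avail_succ, if_neg (by simp [h0])]
      rfl
    · have h0 : digit (m + 1) s p ≠ 0 := by intro h''; simp [h''] at h
      have hD : Dom (val (ord p)) (g + 1) (digit (m + 1) s p) := by
        by_contra h''; simp [h''] at h'
      rw [avail_succ, if_pos ⟨h0, hD⟩]
    · have hD : ¬ Dom (val (ord p)) (g + 1) (digit (m + 1) s p) := by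
        intro h''; simp [h''] at h'
      rw [avail_succ, if_neg (fun h => hD h.2)]
      rfl
  · simp only [Finset.sum_const, Finset.card_range, smul_eq_mul]
    omega
  · omega

theorem code_succ_right (b p : ℕ) (ℓ : ℕ → ℕ) : code b (p + 1) ℓ = code b p ℓ + ℓ p * b ^ p :=
  Finset.sum_range_succ _ _

/-- A round takes work `O(k * m)` and depth `O(k * L²)`: the remaining goods are found once in the
beginning, and updated after each of the `k` choices. -/
theorem runs_roundProg (hS : Sizes n m k L B) (hord : ∀ p < n, ord p < n) {s : ℕ}
    (hs : s < (m + 1) ^ k) :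
    Runs roundProg (.nat s :: globals n m k L val ord inp)
      (.nat (roundMap (fun p => val (ord p)) m k L s))
      (300 * ((k + 1) * (m + 1))) (300 * ((k + 1) * (L + 1) ^ 2)) B := by
  have hm := hS.m_le
  have hkn := hS.k_le_n
  have hL := hS.L_le
  have hclog := hS.clog_le
  have hN := hS.states_le
  set w : ℕ → ℕ → ℝ := fun p => val (ord p) with hw
  set a : ℕ → ℕ := avail w m k (digit (m + 1) s) with ha
  have hrem : ∀ p g, rem w L a p g ≤ m := rem_le (avail_le _)
  have hrem0 : ∀ p g, m ≤ g → rem w L a p g = 0 := fun p g hg =>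
    rem_eq_zero_of_le (Nat.zero_le p) (avail_eq_zero hg)
  have hcode : ∀ p ≤ k, code (m + 1) p (newDigit w m k L s) ≤ B := fun p hp =>
    (code_le_of_le hp).trans ((roundMap_lt (w := w) (m := m) (k := k) (L := L) s).le.trans hN)
  refine (Runs.snd (Runs.forLoop (k := k)
    (s := fun p => .pair (words m (rem w L a p)) (.nat (code (m + 1) p (newDigit w m k L s))))
    (Db := 60 * (L + 1) ^ 2) (fun _ => 130 * (m + 1)) (Runs.var rfl)
    ((runs_availProg hS hord (by omega)).par (Runs.const (Nat.zero_le _)))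
    (by omega) (fun p hp => ?_))).mono ?_ ?_
  · have htree := runs_treeProg (ρ := .nat (ord p) ::
        .pair (words m (rem w L a p)) (.nat (code (m + 1) p (newDigit w m k L s))) :: .nat p ::
        .nat s :: globals n m k L val ord inp) (B := B) (A := .fst (.var 1)) (pT := .var 5)
      (body := .ite (domProg (.var 14) (.var 5) (.var 1) (.var 0)) (.var 1) (.var 0))
      (c := better (w p)) (x := rem w L a p) (l := m) (T := L) (L := L) (M := m) (Wc := 32)
      (Dc := 32) (Runs.fst (Runs.var rfl)) (Runs.var rfl) (better_zero_zero _) (hrem0 p)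
      (fun a b => by unfold better; split_ifs <;> simp) (hrem p) hm hS.lt_pow.le
      (fun x y i st j hx hy => by
        refine (Runs.ite (runs_domProg (n := n) (m := m) (val := val) (Runs.var rfl) (Runs.var rfl)
          (Runs.var rfl) (Runs.var rfl) (hord p (by omega)) hx hy (by omega))
          (fun h => (Runs.var rfl).congr ?_) (fun h => (Runs.var rfl).congr ?_)).mono
          (by norm_num) (by norm_num)
        · have hD : Dom (w p) x y := by by_contra h'; simp [hw] at h'; simp [h'] at h
          simp [better, hD]
        · have hD : ¬ Dom (w p) x y := by intro h'; simp [hw] at h'; simp [h'] at h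
          simp [better, hD])
    have hz : tree (better (w p)) (rem w L a p) L 0 = pick w L a p := rfl
    rw [hz] at htree
    have hstep : code (m + 1) p (newDigit w m k L s) + newDigit w m k L s p * (m + 1) ^ p ≤ B := by
      rw [← code_succ_right]
      exact hcode (p + 1) hp
    refine Runs.mono (Runs.letIn (Runs.get (k := n) (f := fun i => .nat (ord i)) (Runs.var rfl)
        (Runs.var rfl) (by omega : p < n))
      (Runs.letIn htree
        (Runs.par
          (Runs.tab (k := m) (f := fun g => .nat (rem w L a (p + 1) g)) (Runs.var rfl)
            (fun g hg => Runs.letIn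
              (Runs.get (k := m) (f := fun g => .nat (rem w L a p g)) (Runs.fst (Runs.var rfl))
                (Runs.var rfl) hg)
              (Runs.ite ((Runs.var rfl).eq (Runs.var rfl) (by omega))
                (fun h => (Runs.const (Nat.zero_le _)).congr ?_)
                (fun h => (Runs.var rfl).congr ?_))))
          (((Runs.snd (Runs.var rfl)).add
            (Runs.mul (x := newDigit w m k L s p) (y := (m + 1) ^ p)
              (Runs.ite (x := pick w L a p) (Runs.var rfl)
                (fun h => (Runs.var rfl).congr ?_)
                (fun h => (runs_digitProg (m := m) (k := k) (s := s) (p := p) (Runs.var rfl)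
                  (Runs.var rfl) (Runs.var rfl) (Runs.var rfl) hp.le (by omega) (by omega)).congr
                  ?_))
              (Runs.get (k := k + 1) (f := fun i => .nat ((m + 1) ^ i)) (Runs.var rfl)
                (Runs.var rfl) (by omega))
              (le_trans (Nat.le_add_left _ _) hstep)) hstep).congr ?_)))) ?_ ?_
    · have hD : rem w L a p g = pick w L a p := by by_contra h'; simp [h'] at h
      rw [rem_succ, if_pos hD]
    · have hD : ¬ rem w L a p g = pick w L a p := by intro h'; simp [h'] at h
      rw [rem_succ, if_neg hD]
      rfl
    · rw [newDigit, if_neg h]; rfl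
    · rw [newDigit, if_pos h]
    · rw [code_succ_right]
    · norm_num
      omega
    · have h1 : max (11 + Nat.clog 2 m + 1) 18 ≤ L + 18 := by omega
      have h2 : 60 * (L + 1) ^ 2 = 60 * (L * L) + 120 * L + 60 := by ring
      have h3 : L * (32 + L + 23) = L * L + 55 * L := by ring
      norm_num at h1 ⊢
      omega
  · have h1 : m * (62 * k + 8) = 62 * (m * k) + 8 * m := by ring
    have h2 : k * (130 * (m + 1) + 2) = 130 * (m * k) + 132 * k := by ring
    have h3 : 300 * ((k + 1) * (m + 1)) = 300 * (m * k) + 300 * k + 300 * m + 300 := by ring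
    rw [Finset.sum_const, Finset.card_range, smul_eq_mul]
    omega
  · have h1 : L + 1 ≤ (L + 1) ^ 2 := Nat.le_self_pow two_ne_zero _
    have h2 : k * (60 * (L + 1) ^ 2 + 2) = 60 * (k * (L + 1) ^ 2) + 2 * k := by ring
    have h3 : 300 * ((k + 1) * (L + 1) ^ 2) = 300 * (k * (L + 1) ^ 2) + 300 * (L + 1) ^ 2 := by ring
    have h4 : k ≤ k * (L + 1) ^ 2 := Nat.le_mul_of_pos_right _ (by positivity)
    omega

/-! ### The program for the owners of the goods -/

/-- One step of pointer doubling. The state is a pair of arrays: the first one holds the iterate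
`2 ^ j` of the round map, and the second one the orbit of `0` of length `2 ^ j`. -/
def doubleProg : Prog :=
  .par
    (.tab (.len (.fst (.var 0))) (.get (.fst (.var 1)) (.get (.fst (.var 1)) (.var 0))))
    (.tab (.op .mul (.const 2) (.len (.snd (.var 0)))) <|
      .ite (.op .le (.len (.snd (.var 1))) (.var 0))
        (.get (.fst (.var 1))
          (.get (.snd (.var 1)) (.op .sub (.var 0) (.len (.snd (.var 1))))))
        (.get (.snd (.var 1)) (.var 0)))

/-- The orbit of `0` under the round map, on the variables `globals`. -/
def orbitProg : Prog :=
  .snd <| .loop (.var 1)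
    (.par (.tab (.get (.var 0) (.var 2)) roundProg) (.tab (.const 1) (.const 0)))
    (.const 1) doubleProg

/-- The list of the owners, if the orbit of `0` is bound in front of the variables `globals`. -/
def ownerProg : Prog :=
  .tab (.var 4) <| .get (.var 6) <| .op .sub
    (treeProg
      (.tab (.op .mul (.len (.var 1)) (.var 4)) <|
        .letIn (digitProg (.var 6) (.var 3) (.get (.var 2) (.op .div (.var 0) (.var 5)))
          (.op .mod (.var 0) (.var 5))) <|
        .ite (.op .eq (.var 0) (.op .add (.var 2) (.const 1)))
          (.op .add (.op .mod (.var 1) (.var 6)) (.const 1)) (.const 0))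
      (.op .mul (.const 2) (.var 3))
      (.ite (.var 1) (.var 1) (.var 0)))
    (.const 1)

/-- The least `L` with `m < 2 ^ L`, if `m` is the variable `1`. -/
def logProg : Prog :=
  .fst <| .loop (.var 1) (.par (.const 0) (.const 1)) (.op .le (.snd (.var 0)) (.var 3))
    (.par (.op .add (.fst (.var 0)) (.const 1)) (.op .mul (.const 2) (.snd (.var 0))))

/-- The powers of `m + 1` with exponents up to `k`, if `k` and `m` are the variables `1` and `2`. -/
def powProg : Prog :=
  .tab (.op .add (.var 1) (.const 1)) <| .loop (.var 0) (.const 1) (.const 1) <|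
    .op .mul (.var 0) (.op .add (.var 5) (.const 1))

/-- The whole algorithm. -/
def mainProg : Prog :=
  .letIn (.fst (.var 0)) <|
  .letIn (.snd (.var 1)) <|
  .letIn (.len (.get (.var 1) (.const 0))) <|
  .letIn (.ite (.op .le (.len (.var 1)) (.var 0)) (.len (.var 1)) (.var 0)) <|
  .letIn logProg <|
  .letIn powProg <|
  .letIn orbitProg ownerProg

theorem Sizes.clog_states (hS : Sizes n m k L B) : Nat.clog 2 ((m + 1) ^ k) ≤ k * L := by
  refine Nat.clog_le_of_le_pow ?_
  rw [mul_comm k, pow_mul]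
  exact Nat.pow_le_pow_left hS.lt_pow k

theorem runs_doubleProg (hS : Sizes n m k L B) {f : ℕ → ℕ} (hf : ∀ s, f s < (m + 1) ^ k) {j : ℕ}
    (hj : j < L) {x : Val} {ρ : List Val} :
    Runs doubleProg
      (.pair (words ((m + 1) ^ k) f^[2 ^ j]) (words (2 ^ j) fun t => f^[t] 0) :: x :: ρ)
      (.pair (words ((m + 1) ^ k) f^[2 ^ (j + 1)]) (words (2 ^ (j + 1)) fun t => f^[t] 0))
      (8 * (m + 1) ^ k + 18 * 2 ^ L + 11) (k * L + L + 24) B := by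
  have hm := hS.m_le
  have hN := hS.states_le
  have hclog := hS.clog_states
  have hpos : 0 < (m + 1) ^ k := by positivity
  have hit : ∀ t s, s < (m + 1) ^ k → f^[t] s < (m + 1) ^ k := by
    intro t s hs
    cases t with
    | zero => exact hs
    | succ t => rw [Function.iterate_succ_apply']; exact hf _
  have hpow : 2 * 2 ^ j ≤ 2 ^ L := by
    rw [← pow_succ']
    exact Nat.pow_le_pow_right two_pos hj
  have hpowB := hpow.trans hS.pow_le
  have hclog2 : Nat.clog 2 (2 * 2 ^ j) ≤ L := Nat.clog_le_of_le_pow hpow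
  rw [pow_succ']
  refine Runs.mono (Runs.par
    (Runs.tab (k := (m + 1) ^ k) (f := fun s => .nat (f^[2 * 2 ^ j] s))
      (Runs.len (f := fun s => .nat (f^[2 ^ j] s)) (Runs.fst (Runs.var rfl)) hN)
      (fun s hs => (Runs.get (k := (m + 1) ^ k) (f := fun s => .nat (f^[2 ^ j] s))
        (Runs.fst (Runs.var rfl))
        (Runs.get (k := (m + 1) ^ k) (f := fun s => .nat (f^[2 ^ j] s))
          (Runs.fst (Runs.var rfl)) (Runs.var rfl) hs) (hit _ _ hs)).congr ?_))
    (Runs.tab (k := 2 * 2 ^ j) (f := fun t => .nat (f^[t] 0))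
      ((Runs.const (by omega)).mul
        (Runs.len (f := fun s => .nat (f^[s] 0)) (Runs.snd (Runs.var rfl)) (by omega)) hpowB)
      (fun t ht => Runs.ite
        ((Runs.len (k := 2 ^ j) (f := fun s => .nat (f^[s] 0)) (Runs.snd (Runs.var rfl))
          (by omega)).le (Runs.var rfl) (by omega))
        (fun h => (Runs.get (k := (m + 1) ^ k) (f := fun s => .nat (f^[2 ^ j] s))
          (Runs.fst (Runs.var rfl))
          (Runs.get (k := 2 ^ j) (f := fun s => .nat (f^[s] 0)) (x := t - 2 ^ j)
            (Runs.snd (Runs.var rfl))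
            ((Runs.var rfl).sub (Runs.len (k := 2 ^ j) (f := fun s => .nat (f^[s] 0))
              (Runs.snd (Runs.var rfl)) (by omega)) (by omega)) (by omega))
          (hit _ _ hpos)).congr ?_)
        (fun h => Runs.get (k := 2 ^ j) (f := fun s => .nat (f^[s] 0))
          (Runs.snd (Runs.var rfl)) (Runs.var rfl) ?_)))) ?_ ?_
  · rw [two_mul, Function.iterate_add_apply]
  · have hle : 2 ^ j ≤ t := by by_contra h'; simp [h'] at h
    rw [← Function.iterate_add_apply, Nat.add_sub_cancel' hle]
  · by_contra h'
    simp [Nat.not_lt.1 h'] at h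
  · norm_num
    omega
  · norm_num
    omega

/-- The dominant part of the work is the tabulation of the round map on `(m + 1) ^ k` words. -/
theorem runs_orbitProg (hS : Sizes n m k L B) (hord : ∀ p < n, ord p < n) :
    Runs orbitProg (globals n m k L val ord inp)
      (words (2 ^ L) fun t => (roundMap (fun p => val (ord p)) m k L)^[t] 0)
      (400 * ((k + 1) * (m + 1) * (m + 1) ^ k)) (400 * ((k + 1) * (L + 1) ^ 2)) B := by
  have hm := hS.m_le
  have hL := hS.L_le
  have hN := hS.states_le
  have hclog := hS.clog_states
  have hp2 := hS.pow_le_double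
  have hN' := hS.le_states
  set f := roundMap (fun p => val (ord p)) m k L with hf
  refine Runs.mono (Runs.snd (Runs.forLoop (k := L)
    (s := fun j => .pair (words ((m + 1) ^ k) f^[2 ^ j]) (words (2 ^ j) fun t => f^[t] 0))
    (fun _ => 8 * (m + 1) ^ k + 18 * 2 ^ L + 11) (Runs.var rfl)
    (Runs.par
      (Runs.tab (k := (m + 1) ^ k) (f := fun s => .nat (f s))
        (Runs.get (k := k + 1) (f := fun i => .nat ((m + 1) ^ i)) (Runs.var rfl) (Runs.var rfl)
          (Nat.lt_succ_self k))
        (fun s hs => runs_roundProg hS hord hs))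
      (Runs.tab (k := 1) (f := fun t => .nat (f^[t] 0)) (Runs.const (by omega))
        (fun t ht => (Runs.const (Nat.zero_le B)).congr ?_)))
    (by omega) (fun j hj => runs_doubleProg hS (roundMap_lt (L := L)) hj))) ?_ ?_
  · obtain rfl : t = 0 := by omega
    rfl
  · rw [Finset.sum_const, Finset.card_range, smul_eq_mul]
    set N := (m + 1) ^ k with hNdef
    have h1 : L * (8 * N + 18 * 2 ^ L + 11 + 2) ≤ (m + 1) * (8 * N + 36 * N + 13) :=
      Nat.mul_le_mul (by omega) (by omega)
    have h2 : (m + 1) * (8 * N + 36 * N + 13) = 44 * ((m + 1) * N) + 13 * (m + 1) := by ring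
    have h3 : N * (300 * ((k + 1) * (m + 1))) = 300 * ((k + 1) * (m + 1) * N) := by ring
    have h4 : (m + 1) * N ≤ (k + 1) * (m + 1) * N := by
      rw [mul_assoc]; exact Nat.le_mul_of_pos_left _ (Nat.succ_pos k)
    have h5 : N ≤ (m + 1) * N := Nat.le_mul_of_pos_left _ (Nat.succ_pos m)
    norm_num
    omega
  · have h0 : Nat.clog 2 1 = 0 := by simp
    have h1 : L * (k * L + L + 24 + 2) ≤ 26 * ((k + 1) * (L + 1) ^ 2) := by
      nlinarith [Nat.zero_le (k * L), Nat.zero_le (k * (L * L)), Nat.zero_le (L * L)]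
    have h2 : k * L ≤ (k + 1) * (L + 1) ^ 2 := by
      nlinarith [Nat.zero_le (k * L), Nat.zero_le (k * (L * L)), Nat.zero_le (L * L)]
    have h3 : 1 ≤ (k + 1) * (L + 1) ^ 2 := Nat.one_le_iff_ne_zero.2 (by positivity)
    rw [h0]
    omega

theorem trace_le (w : ℕ → ℕ → ℝ) (g q : ℕ) : trace w m k L g q ≤ k := by
  unfold trace
  split_ifs with h <;> try exact Nat.zero_le _
  have : 0 < k := Nat.pos_of_ne_zero fun h' => by simp [h'] at h
  exact Nat.mod_lt _ this

theorem ownerPos_le (w : ℕ → ℕ → ℝ) (g : ℕ) : ownerPos w m k L g ≤ k := by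
  obtain ⟨q, -, e⟩ := exists_tree_eq (c := firstNonzero) (x := trace w m k L g)
    (fun a b => by unfold firstNonzero; split_ifs <;> simp) (2 * L) 0
  rw [ownerPos, e]
  exact trace_le w g q

theorem runs_ownerProg (hS : Sizes n m k L B) (hn : 0 < n) :
    Runs ownerProg
      ((words (2 ^ L) fun t => (roundMap (fun p => val (ord p)) m k L)^[t] 0) ::
        globals n m k L val ord inp)
      (words m fun g => ord (ownerPos (fun p => val (ord p)) m k L g - 1))
      (200 * ((k + 1) * (m + 1) * (m + 1) ^ k)) (200 * ((k + 1) * (L + 1) ^ 2)) B := by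
  have hm := hS.m_le
  have hkn := hS.k_le_n
  have hkm := hS.k_le_m
  have hL := hS.L_le
  have hN := hS.states_le
  have hp2 := hS.pow_le_double
  have hpB := hS.pow_le
  have hN' := hS.le_states
  have htr := hS.trace_le
  have hmL := hS.lt_pow
  set w : ℕ → ℕ → ℝ := fun p => val (ord p) with hw
  set f := roundMap w m k L with hf
  have hcl : 2 ^ L * k ≤ 2 ^ (2 * L) := by
    rw [two_mul, pow_add]
    exact Nat.mul_le_mul_left _ (by omega)
  have hit : ∀ t, f^[t] 0 ≤ B := by
    intro t
    cases t with
    | zero => exact Nat.zero_le _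
    | succ t => rw [Function.iterate_succ_apply']; exact (roundMap_lt _).le.trans hN
  have hclog := hS.clog_le
  have hclog2 : Nat.clog 2 (2 ^ L * k) ≤ 2 * L := Nat.clog_le_of_le_pow hcl
  refine Runs.mono (Runs.tab (f := fun g => .nat (ord (ownerPos w m k L g - 1))) (Runs.var rfl)
    (fun g hg => Runs.get (k := n) (f := fun p => .nat (ord p)) (Runs.var rfl)
      (Runs.sub
        (runs_treeProg (c := firstNonzero) (x := trace w m k L g) (l := 2 ^ L * k) (T := 2 * L)
          (M := k) (L := 2 * L) (Wc := 3) (Dc := 3)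
          (Runs.tab (k := 2 ^ L * k) (f := fun q => .nat (trace w m k L g q))
            ((Runs.len (f := fun t => .nat (f^[t] 0)) (Runs.var rfl) hpB).mul (Runs.var rfl)
              (by omega))
            (fun q hq => Runs.letIn
              (runs_digitProg (m := m) (k := k) (s := f^[q / k] 0) (p := q % k) (Runs.var rfl)
                (Runs.var rfl)
                (Runs.get (k := 2 ^ L) (f := fun t => .nat (f^[t] 0)) (Runs.var rfl)
                  ((Runs.var rfl).div (Runs.var rfl) (by omega))
                  ((Nat.div_lt_iff_lt_mul (by by_contra h; simp [Nat.eq_zero_of_not_pos h] at hq)).2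
                    hq))
                ((Runs.var rfl).mod (Runs.var rfl) (by omega))
                (Nat.mod_lt _ (by by_contra h; simp [Nat.eq_zero_of_not_pos h] at hq)).le
                (hit _) (by omega))
              (Runs.ite
                ((Runs.var rfl).eq ((Runs.var rfl).add (Runs.const (by omega))
                  (by omega : g + 1 ≤ B)) (by omega))
                (fun h => (((Runs.var rfl).mod (Runs.var rfl) (by omega)).add
                  (Runs.const (by omega)) ?_).congr ?_)
                (fun h => (Runs.const (Nat.zero_le _)).congr ?_))))
          ((Runs.const (by omega)).mul (Runs.var rfl) hS.double_le) rfl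
          (fun q hq => if_neg (by omega))
          (fun a b => by unfold firstNonzero; split_ifs <;> simp) (trace_le w g) htr hcl
          (fun a b i st j ha hb => (Runs.ite (x := a) (Runs.var rfl)
            (fun h => (Runs.var rfl).congr (by simp [firstNonzero, h]))
            (fun h => (Runs.var rfl).congr (by simp [firstNonzero, h]))).mono
              (by norm_num) (by norm_num)))
        (Runs.const (by omega)) ((ownerPos_le w g).trans (by omega)))
      ?_)) ?_ ?_
  · have := Nat.mod_le q k
    omega
  · have hD : digit (m + 1) (f^[q / k] 0) (q % k) = g + 1 := by by_contra h'; simp [h'] at h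
    rw [trace, if_pos hq, if_pos hD]
  · have hD : ¬ digit (m + 1) (f^[q / k] 0) (q % k) = g + 1 := by intro h'; simp [h'] at h
    rw [trace, if_pos hq, if_neg hD]
  · have := ownerPos_le (m := m) (k := k) (L := L) w g
    change ownerPos w m k L g - 1 < n
    omega
  · set N := (m + 1) ^ k with hNdef
    have h1 : 2 ^ L * k ≤ 2 * (m + 1) * k := Nat.mul_le_mul_right _ hp2
    have h2 : m * (120 * (m + 1) * k + 54 * m + 30) ≤ 184 * ((k + 1) * (m + 1) * (m + 1)) := by
      nlinarith [Nat.zero_le (m * k), Nat.zero_le (m * (m * k))]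
    have h3 : (k + 1) * (m + 1) * (m + 1) ≤ (k + 1) * (m + 1) * N := Nat.mul_le_mul_left _ hN'
    have h4 : (m + 1) ≤ (k + 1) * (m + 1) * N := by
      rw [mul_assoc]
      exact (Nat.le_mul_of_pos_right _ (by positivity)).trans
        (Nat.le_mul_of_pos_left _ (Nat.succ_pos k))
    have h5 :
        1 + (4 + 2 ^ L * k * 27 + 2 ^ L * k + 1 + 3 + (2 ^ L * k + 2 * L) * 27 + 5 + 1 + 1) + 1 ≤
          120 * (m + 1) * k + 54 * m + 30 := by
      have : 120 * (m + 1) * k = 60 * (2 * (m + 1) * k) := by ring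
      omega
    have h6 := Nat.mul_le_mul_left m h5
    norm_num
    omega
  · have h1 : 2 * L * (3 + 2 * L + 23) ≤ 56 * ((k + 1) * (L + 1) ^ 2) := by
      nlinarith [Nat.zero_le (k * L), Nat.zero_le (k * (L * L)), Nat.zero_le (L * L)]
    have h2 : L + 1 ≤ (k + 1) * (L + 1) ^ 2 := by
      nlinarith [Nat.zero_le (k * L), Nat.zero_le (k * (L * L)), Nat.zero_le (L * L)]
    norm_num at h1 ⊢
    omega

theorem runs_logProg {x : Val} {ρ : List Val} (hB : 2 ≤ B) (hL : L = Nat.clog 2 (m + 1))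
    (hLm : L ≤ m) (hm : m ≤ B) (hpow : 2 ^ L ≤ B) :
    Runs logProg (x :: .nat m :: ρ) (.nat L) (20 * (L + 1)) (20 * (L + 1)) B := by
  have hlt : ∀ j, j < L ↔ 2 ^ j ≤ m := fun j => by
    rw [hL, Nat.lt_clog_iff_pow_lt one_lt_two, Nat.lt_succ_iff]
  have hle : ∀ j ≤ L, 2 ^ j ≤ B := fun j hj => (Nat.pow_le_pow_right two_pos hj).trans hpow
  have hLB : L ≤ B := hLm.trans hm
  refine Runs.mono (Runs.fst (Runs.loop (k := m) (J := L)
    (s := fun j => .pair (.nat j) (.nat (2 ^ j))) (Wb := fun _ => 9) (Db := 5) (Runs.var rfl)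
    (Runs.par (Runs.const (Nat.zero_le _)) (Runs.const (by omega : 1 ≤ B))) hLm
    (fun j hj => (Runs.le (Runs.snd (Runs.var rfl)) (Runs.var rfl) (by omega)).congr
      (by rw [if_pos ((hlt j).1 hj)]))
    (fun j hj => (Runs.par
      ((Runs.fst (Runs.var rfl)).add (Runs.const (by omega : 1 ≤ B)) (by omega))
      ((Runs.const hB).mul (Runs.snd (Runs.var rfl)) (?_ : 2 * 2 ^ j ≤ B))).congr ?_)
    (fun _ => (Runs.le (Runs.snd (Runs.var rfl)) (Runs.var rfl) (by omega)).congr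
      (by rw [if_neg fun h => lt_irrefl L ((hlt L).2 h)])))) ?_ ?_
  · rw [← pow_succ']
    exact hle _ hj
  · rw [← pow_succ']
  · rw [Finset.sum_const, Finset.card_range, smul_eq_mul]
    omega
  · omega

theorem runs_powProg {x : Val} {ρ : List Val} (hkm : k ≤ m) (hm : m + 2 ≤ B) (hmL : m < 2 ^ L)
    (hN : (m + 1) ^ k ≤ B) :
    Runs powProg (x :: .nat k :: .nat m :: ρ) (words (k + 1) fun i => (m + 1) ^ i)
      (20 * ((k + 1) * (m + 1))) (20 * (k + 1) + L) B := by
  have hclog : Nat.clog 2 (k + 1) ≤ L := Nat.clog_le_of_le_pow (by omega)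
  have hp : ∀ i ≤ k, (m + 1) ^ i ≤ B := fun i hi =>
    (Nat.pow_le_pow_right (Nat.succ_pos m) hi).trans hN
  refine Runs.mono (Runs.tab (k := k + 1) (f := fun i => .nat ((m + 1) ^ i)) (W₂ := 5 + 7 * k)
    (D₂ := 5 + 7 * k)
    ((Runs.var rfl).add (Runs.const (by omega)) (by omega)) (fun i hi =>
      (Runs.forLoop (k := i) (s := fun j => .nat ((m + 1) ^ j)) (Db := 5) (fun _ => 5)
        (Runs.var rfl) (Runs.const (k := 1) (by omega)) (by omega) (fun j hj =>
          (((Runs.var rfl).mul ((Runs.var rfl).add (Runs.const (by omega : 1 ≤ B)) (by omega))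
            ?_).congr ?_).mono (by norm_num) (by norm_num))).mono ?_ ?_)) ?_ ?_
  · rw [← pow_succ]
    exact hp _ (by omega)
  · rw [← pow_succ]
  · rw [Finset.sum_const, Finset.card_range, smul_eq_mul]
    omega
  · omega
  · nlinarith
  · omega

theorem runs_mainProg (hS : Sizes n m k L B) (hn : 0 < n) (hk : k = min n m)
    (hL : L = Nat.clog 2 (m + 1)) (hord : ∀ p < n, ord p < n) :
    Runs mainProg [.pair (valueTable n m val) (words n ord)]
      (words m fun g => ord (ownerPos (fun p => val (ord p)) m k L g - 1))
      (1000 * ((k + 1) * (m + 1) * (m + 1) ^ k)) (1000 * ((k + 1) * (L + 1) ^ 2)) B := by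
  have hm := hS.m_le
  have hnB := hS.n_le
  have hLm := hS.L_le
  refine Runs.mono (Runs.letIn (Runs.fst (Runs.var rfl)) (Runs.letIn (Runs.snd (Runs.var rfl))
    (Runs.letIn
      (Runs.len (k := m) (f := fun g => .real (val 0 g))
        (Runs.get (k := n) (f := fun a => .tabulate m fun g => .real (val a g)) (Runs.var rfl)
          (Runs.const (Nat.zero_le _)) hn) (by omega))
      (Runs.letIn
        (Runs.ite (v := .nat k)
          (Runs.le (Runs.len (k := n) (f := fun p => .nat (ord p)) (Runs.var rfl) hnB)
            (Runs.var rfl) (by omega))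
          (fun h => (Runs.len (k := n) (f := fun p => .nat (ord p)) (Runs.var rfl) hnB).congr ?_)
          (fun h => (Runs.var rfl).congr ?_))
        (Runs.letIn (runs_logProg (by omega) hL hLm (by omega) hS.pow_le)
          (Runs.letIn (runs_powProg hS.k_le_m hm hS.lt_pow hS.states_le)
            (Runs.letIn (runs_orbitProg (n := n) (val := val) hS hord)
              (runs_ownerProg hS hn)))))))) ?_ ?_
  · have : n ≤ m := by by_contra h'; simp [h'] at h
    rw [hk, min_eq_left this]
  · have : ¬ n ≤ m := by intro h'; simp [h'] at h
    rw [hk, min_eq_right (by omega)]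
    rfl
  · have h1 : L + 1 ≤ (k + 1) * (m + 1) := by nlinarith [Nat.zero_le (k * m)]
    have h2 : (k + 1) * (m + 1) ≤ (k + 1) * (m + 1) * (m + 1) ^ k :=
      Nat.le_mul_of_pos_right _ (by positivity)
    norm_num
    omega
  · have h1 : L + 1 ≤ (k + 1) * (L + 1) ^ 2 := by
      nlinarith [Nat.zero_le (k * L), Nat.zero_le (k * (L * L)), Nat.zero_le (L * L)]
    have h2 : k + 1 ≤ (k + 1) * (L + 1) ^ 2 := Nat.le_mul_of_pos_right _ (by positivity)
    norm_num
    omega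

end RoundRobin

namespace OrderedInstance

open ForkJoin RoundRobin

variable (I : OrderedInstance)

/-! ### Bounds in the size of the instance -/

/-- By `(1 + 1 / m) ^ m ≤ e < 3`. -/
theorem add_one_pow_le {m k : ℕ} (h : k ≤ m) : (m + 1) ^ k ≤ 3 * m ^ k := by
  rcases Nat.eq_zero_or_pos m with rfl | hm
  · obtain rfl : k = 0 := by omega
    simp
  have hm' : (0 : ℝ) < m := by exact_mod_cast hm
  have h1 : ((m : ℝ) + 1) ^ k ≤ 3 * (m : ℝ) ^ k := by
    have e : (m : ℝ) + 1 = m * (1 / m + 1) := by field_simp; ring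
    have h2 : (1 / (m : ℝ) + 1) ^ k ≤ 3 := by
      calc (1 / (m : ℝ) + 1) ^ k ≤ Real.exp (1 / m) ^ k :=
            pow_le_pow_left₀ (by positivity) (Real.add_one_le_exp _) k
        _ ≤ Real.exp 1 := by
            rw [← Real.exp_nat_mul]
            apply Real.exp_le_exp.2
            rw [mul_one_div, div_le_one hm']
            exact_mod_cast h
        _ ≤ 3 := by linarith [Real.exp_one_lt_d9]
    rw [e, mul_pow, mul_comm]
    gcongr
  exact_mod_cast h1

/-- The greatest word that the algorithm may use. -/
def wordBound : ℕ := I.n + 2 * (I.m + 1) ^ 2 + (I.m + 1) ^ min I.n I.m + 4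

theorem sizes : Sizes I.n I.m (min I.n I.m) (Nat.clog 2 (I.m + 1)) I.wordBound := by
  have hn := I.n_pos
  have hL : Nat.clog 2 (I.m + 1) ≤ I.m := Nat.clog_le_of_le_pow Nat.lt_two_pow_self
  have h2 : 2 ^ Nat.clog 2 (I.m + 1) ≤ 2 * (I.m + 1) := by
    rcases Nat.eq_zero_or_pos (Nat.clog 2 (I.m + 1)) with h | h
    · rw [h]; omega
    · have := Nat.pow_lt_of_lt_clog (b := 2) (x := I.m + 1)
        (y := Nat.clog 2 (I.m + 1) - 1) (by omega)
      obtain ⟨l, hl⟩ := Nat.exists_eq_add_of_lt h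
      rw [show Nat.clog 2 (I.m + 1) = l + 1 by omega] at this ⊢
      rw [pow_succ']
      rw [Nat.add_sub_cancel] at this
      omega
  have hsq : (I.m + 1) ^ 2 = I.m * I.m + 2 * I.m + 1 := by ring
  have hkm : min I.n I.m ≤ I.m := min_le_right _ _
  have h3 : 2 ^ Nat.clog 2 (I.m + 1) * min I.n I.m ≤ 2 * (I.m + 1) * I.m := Nat.mul_le_mul h2 hkm
  have h4 : 2 * (I.m + 1) * I.m = 2 * (I.m * I.m) + 2 * I.m := by ring
  have hB : I.wordBound = I.n + 2 * (I.m + 1) ^ 2 + (I.m + 1) ^ min I.n I.m + 4 := rfl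
  refine ⟨min_le_left _ _, hkm, Nat.le_pow_clog one_lt_two _, hL, ?_, ?_, ?_, ?_, ?_, ?_, h2, ?_⟩
  any_goals omega
  rcases Nat.eq_zero_or_pos I.m with h | h
  · simp [h]
  · exact Nat.le_self_pow (Nat.pos_iff_ne_zero.1 (lt_min hn h)) _

theorem runs_encode : Runs mainProg [I.encode]
    (.tabulate I.m fun g => .nat (I.agentAt
      (ownerPos (fun p => I.valueAt (I.agentAt p)) I.m (min I.n I.m)
        (Nat.clog 2 (I.m + 1)) g - 1)))
    (1000 * ((min I.n I.m + 1) * (I.m + 1) * (I.m + 1) ^ min I.n I.m))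
    (1000 * ((min I.n I.m + 1) * (Nat.clog 2 (I.m + 1) + 1) ^ 2)) I.wordBound := by
  rw [encode_eq]
  exact runs_mainProg I.sizes I.n_pos rfl rfl fun p => I.agentAt_lt

theorem solves_run : I.Solves (mainProg.run [I.encode]).val := by
  rw [I.runs_encode.val]
  exact I.solves_owner (Nat.le_pow_clog one_lt_two _)

theorem clog_add_one_le {m s : ℕ} (h : m < s) : Nat.clog 2 (m + 1) ≤ Nat.log 2 s + 1 :=
  Nat.clog_le_of_le_pow (h.trans (Nat.lt_pow_succ_log_self one_lt_two s))

theorem work_le (hm : 2 ≤ I.m) :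
    (mainProg.run [I.encode]).work ≤ 100000 * (I.n * I.m ^ (I.n + 1)) := by
  refine I.runs_encode.work.trans ?_
  have hn := I.n_pos
  have h1 : (I.m + 1) ^ min I.n I.m ≤ 3 * I.m ^ I.n :=
    (add_one_pow_le (min_le_right _ _)).trans
      (Nat.mul_le_mul_left _ (Nat.pow_le_pow_right (by omega) (min_le_left _ _)))
  calc 1000 * ((min I.n I.m + 1) * (I.m + 1) * (I.m + 1) ^ min I.n I.m)
      ≤ 1000 * ((2 * I.n) * (2 * I.m) * (3 * I.m ^ I.n)) := by
        have : min I.n I.m ≤ I.n := min_le_left _ _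
        gcongr <;> omega
    _ = 12000 * (I.n * I.m ^ (I.n + 1)) := by ring
    _ ≤ _ := Nat.mul_le_mul_right _ (by norm_num)

theorem depth_le (hm : 2 ≤ I.m) :
    (mainProg.run [I.encode]).depth ≤ 100000 * (I.n ^ 2 * Nat.log 2 I.m ^ 2) := by
  refine I.runs_encode.depth.trans ?_
  have hn := I.n_pos
  have hlog : 1 ≤ Nat.log 2 I.m := Nat.log_pos one_lt_two hm
  have hL : Nat.clog 2 (I.m + 1) ≤ Nat.log 2 I.m + 1 :=
    Nat.clog_le_of_le_pow (Nat.lt_pow_succ_log_self one_lt_two _)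
  calc 1000 * ((min I.n I.m + 1) * (Nat.clog 2 (I.m + 1) + 1) ^ 2)
      ≤ 1000 * ((2 * I.n) * (3 * Nat.log 2 I.m) ^ 2) := by
        have : min I.n I.m ≤ I.n := min_le_left _ _
        gcongr <;> omega
    _ = 18000 * (I.n * Nat.log 2 I.m ^ 2) := by ring
    _ ≤ 100000 * (I.n ^ 2 * Nat.log 2 I.m ^ 2) := by
        gcongr
        · norm_num
        · exact Nat.le_self_pow two_ne_zero _

theorem word_le (hm : 2 ≤ I.m) : (mainProg.run [I.encode]).word ≤ I.m ^ (100000 * I.n) := by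
  refine I.runs_encode.word.trans ?_
  have hn := I.n_pos
  have hm1 : I.m + 1 ≤ I.m ^ 2 := by nlinarith
  have hmono : ∀ {i j : ℕ}, i ≤ j → I.m ^ i ≤ I.m ^ j := fun h => Nat.pow_le_pow_right (by omega) h
  have h1 : I.n ≤ I.m ^ (5 * I.n) :=
    ((Nat.lt_pow_self (by omega : 1 < I.m)).le).trans (hmono (by omega))
  have h2 : 2 * (I.m + 1) ^ 2 ≤ I.m ^ (5 * I.n) := by
    calc 2 * (I.m + 1) ^ 2 ≤ I.m * (I.m ^ 2) ^ 2 := by gcongr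
      _ = I.m ^ 5 := by ring
      _ ≤ _ := hmono (by omega)
  have h3 : (I.m + 1) ^ min I.n I.m ≤ I.m ^ (5 * I.n) := by
    calc (I.m + 1) ^ min I.n I.m ≤ (I.m ^ 2) ^ min I.n I.m := Nat.pow_le_pow_left hm1 _
      _ = I.m ^ (2 * min I.n I.m) := by rw [pow_mul]
      _ ≤ _ := hmono (by have : min I.n I.m ≤ I.n := min_le_left _ _; omega)
  have h4 : 4 ≤ I.m ^ (5 * I.n) :=
    (Nat.pow_le_pow_left hm 2).trans (hmono (by omega))
  have h5 : 4 ≤ I.m ^ 2 := Nat.pow_le_pow_left hm 2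
  calc I.wordBound ≤ 4 * I.m ^ (5 * I.n) := by rw [wordBound]; omega
    _ ≤ I.m ^ 2 * I.m ^ (5 * I.n) := Nat.mul_le_mul_right _ h5
    _ = I.m ^ (2 + 5 * I.n) := by rw [pow_add]
    _ ≤ _ := hmono (by omega)

theorem size_encode : I.encode.size = 3 + I.n * (1 + I.m) + I.n := by
  simp [encode, Val.size]
  ring

theorem inNC (c : ℕ) : InNC (fun I : {I : OrderedInstance // I.n ≤ c} => I.1.encode)
    (fun I out => I.1.Solves out) := by
  refine ⟨mainProg, 4000 * (c + 1), fun ⟨I, hI⟩ => ⟨I.solves_run, ?_, ?_, ?_⟩⟩ <;> dsimp only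
  all_goals
    have hn := I.n_pos
    have hs := I.size_encode
    set S := I.encode.size with hS
    have hmn : 1 + I.m ≤ I.n * (1 + I.m) := Nat.le_mul_of_pos_left _ hn
    have hmS : I.m + 1 ≤ S := by omega
    have hS1 : 1 ≤ S := by omega
    have hk : min I.n I.m ≤ c := (min_le_left _ _).trans hI
    have hpow : (I.m + 1) ^ min I.n I.m ≤ S ^ c :=
      (Nat.pow_le_pow_left hmS _).trans (Nat.pow_le_pow_right hS1 hk)
  · refine I.runs_encode.work.trans ?_
    calc 1000 * ((min I.n I.m + 1) * (I.m + 1) * (I.m + 1) ^ min I.n I.m)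
        ≤ 1000 * ((c + 1) * S * S ^ c) := by gcongr
      _ = 1000 * (c + 1) * S ^ (c + 1) := by ring
      _ ≤ 4000 * (c + 1) * S ^ (4000 * (c + 1)) := by
        gcongr
        · norm_num
        · omega
  · refine I.runs_encode.depth.trans ?_
    have hL : Nat.clog 2 (I.m + 1) ≤ Nat.log 2 S + 1 := clog_add_one_le hmS
    calc 1000 * ((min I.n I.m + 1) * (Nat.clog 2 (I.m + 1) + 1) ^ 2)
        ≤ 1000 * ((c + 1) * (2 * (Nat.log 2 S + 1)) ^ 2) := by gcongr; omega
      _ = 4000 * (c + 1) * (Nat.log 2 S + 1) ^ 2 := by ring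
      _ ≤ 4000 * (c + 1) * (Nat.log 2 S + 1) ^ (4000 * (c + 1)) := by
        gcongr
        · omega
        · omega
  · refine I.runs_encode.word.trans ?_
    have h1 : I.n ≤ S ^ (c + 2) := le_trans (by omega) (Nat.le_self_pow (by omega : c + 2 ≠ 0) S)
    have h2 : (I.m + 1) ^ 2 ≤ S ^ (c + 2) :=
      (Nat.pow_le_pow_left hmS 2).trans (Nat.pow_le_pow_right hS1 (by omega))
    have h3 : (I.m + 1) ^ min I.n I.m ≤ S ^ (c + 2) :=
      hpow.trans (Nat.pow_le_pow_right hS1 (by omega))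
    have h4 : 1 ≤ S ^ (c + 2) := Nat.one_le_pow _ _ hS1
    calc I.wordBound ≤ 8 * S ^ (c + 2) := by rw [wordBound]; omega
      _ ≤ 4000 * (c + 1) * S ^ (4000 * (c + 1)) := by
        gcongr
        · omega
        · omega

end OrderedInstance

theorem mainTheorem2 :
    (∃ (P : ForkJoin.Prog) (K : ℕ), ∀ I : OrderedInstance,
      I.Solves (P.run [I.encode]).val ∧
      (2 ≤ I.m →
        (P.run [I.encode]).depth ≤ K * (I.n ^ 2 * Nat.log 2 I.m ^ 2) ∧
        (P.run [I.encode]).work ≤ K * (I.n * I.m ^ (I.n + 1)) ∧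
        (P.run [I.encode]).word ≤ I.m ^ (K * I.n))) ∧
    ∀ c : ℕ, ForkJoin.InNC
      (fun I : {I : OrderedInstance // I.n ≤ c} => I.1.encode)
      (fun I out => I.1.Solves out) :=
  ⟨⟨RoundRobin.mainProg, 100000, fun I =>
    ⟨I.solves_run, fun hm => ⟨I.depth_le hm, I.work_le hm, I.word_le hm⟩⟩⟩, OrderedInstance.inNC⟩
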